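/- \textbf{Model of computation.} Let $\mathcal M$ be an asynchronous message-passing system of two processes $p_1,p_2$ without crashes, which exchange messages from a fixed finite set (messages of constant size). Each process is a deterministic Turing machine with a finite control and a two-way infinite tape, almost all of whose cells are blank at the start; the two programs and the two initial tapes are arbitrary. In a \emph{computation step} $p_i$ consults its control state, the scanned symbol, and the oldest message in its inbuffer, if there is one (this message is removed from the inbuffer); it changes its control state, writes a symbol, moves its head by at most one cell and sends at most one message to the other process, unless it halts. In a \emph{delivery} a message in transit to $p_i$ is appended to the inbuffer of $p_i$; messages in transit may be delivered in any order. The \emph{events} are the computation steps and the deliveries. A configuration consists of the control states, the tapes with head positions, the inbuffers, and the messages in transit; at the start the inbuffers are empty and no message is in transit. An infinite execution is admissible if each process takes infinitely many computation steps and every message sent is eventually delivered; there is no bound on delays. As usual, a configuration is considered at a point of an execution: below, a \emph{configuration} $C$ of $\mathcal M$ means a reached configuration together with the finite execution from the start that has led to it. \textbf{Tile assembly.} A tile assembly system $\mathcal T$ (two-dimensional, temperature $2$) has finitely many unrotatable square tile types, a glue name and a glue strength in $\{0,1,2\}$ on each side of each type, a symmetric relation on glue names telling which ones bind (two abutting sides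 bind with their common strength if their names are related and their strengths agree, and with strength $0$ otherwise), and a finite, nonempty, stable seed assembly in $\mathbb Z^2$. A configuration of tiles is \emph{stable} if each of its cuts severs bonds of total strength at least $2$. A tile may be added at an empty position where it binds with total strength at least $2$; $\alpha\longrightarrow\beta$ means that $\beta$ arises from $\alpha$ by finitely many such additions. In \emph{random assembly} each addition is drawn uniformly from all the currently possible ones (position and tile type). \textbf{Simulation.} $\mathcal T$ \emph{simulates} $\mathcal M$ if there is an injective map $h$ from the configurations of $\mathcal M$ to the stable tile configurations of $\mathcal T$, which sends the start configuration to the seed assembly, such that (1) if an event leads from $C$ to $C'$, then $h(C)\longrightarrow h(C')$; (2) if there is no legal execution segment from $C$ to $C'$, then $h(C)\longrightarrow h(C')$ does not hold; (3) if $C$ is a configuration and $\mathcal C$ a set of configurations such that every admissible infinite execution from $C$ passes through $\mathcal C$, then random assembly started at $h(C)$ meets $\{h(C'):C'\in\mathcal C\}$ with probability one; (4) if all processes have halted in $C$, then no tile can be added to $h(C)$. \textbf{Theorem.} Suppose that each process of $\mathcal M$ runs forever, that is, no process has halted in any reachable configuration. Then there is a two-dimensional tile assembly system $\mathcal T$ that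 simulates $\mathcal M$. Moreover, $\mathcal T$ and $h$ can be chosen so that the tiles record the execution: some tile types carry a mark, consisting of an event together with a control state and a scanned symbol for each of the two processes, and whenever an event $\varphi$ leads from $C$ to $C'$, exactly one of the tiles of $h(C')$ at positions that are empty in $h(C)$ is marked, and its mark is $\varphi$ with the control states and scanned symbols in $C'$. -/

import Mathlib

/-! Tile assembly (temperature 2, square grid) and asynchronous two-process message passing. -/

section TileAssembly

/-- The four sides of a unit square tile. -/
inductive Side : Type
  | north
  | south
  | east
  | west

namespace Side

/-- The side of the neighbouring tile that abuts the given side. -/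
def opp : Side → Side
  | north => south
  | south => north
  | east => west
  | west => east

/-- The displacement to the neighbour across the given side. -/
def vec : Side → ℤ × ℤ
  | north => (0, 1)
  | south => (0, -1)
  | east => (1, 0)
  | west => (-1, 0)

end Side

/-- The data of a tile assembly system before the seed is constrained: finitely many
(unrotatable) tile types, a glue name and a strength 0, 1 or 2 on each side of each type, the
symmetric relation telling which glue names bind, and the seed assembly. -/
structure TileData where
  Tile : Type
  Glue : Type
  finite_tile : Finite Tile
  glue : Tile → Side → Glue × Fin 3
  binds : Glue → Glue → Prop
  binds_symm : ∀ g g', binds g g' → binds g' g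
  seed : ℤ × ℤ → Option Tile

namespace TileData

variable (T : TileData)

/-- A tile configuration: a partial placement of tiles on the integer plane. -/
abbrev Assembly : Type := ℤ × ℤ → Option T.Tile

open Classical in
/-- The strength with which side `s` of a tile `t` binds to a tile `u` placed across that side:
the glues must be related and have the same strength, otherwise the strength is 0. -/
noncomputable def bond (t : T.Tile) (s : Side) (u : T.Tile) : ℕ :=
  if T.binds (T.glue t s).1 (T.glue u s.opp).1 ∧ (T.glue t s).2 = (T.glue u s.opp).2 then
    ((T.glue t s).2 : ℕ)
  else 0

/-- The strength with which a tile `t` put at position `p` binds, across its side `s`, to the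
configuration `α`. -/
noncomputable def bondTo (α : T.Assembly) (p : ℤ × ℤ) (t : T.Tile) (s : Side) : ℕ :=
  match α (p + s.vec) with
  | none => 0
  | some u => T.bond t s u

/-- The total strength with which a tile `t` put at position `p` binds to `α`. -/
noncomputable def strength (α : T.Assembly) (p : ℤ × ℤ) (t : T.Tile) : ℕ :=
  T.bondTo α p t .north + T.bondTo α p t .south + T.bondTo α p t .east + T.bondTo α p t .west

/-- The strength of the bond of `α` across side `s` of position `p`. -/
noncomputable def bondAt (α : T.Assembly) (p : ℤ × ℤ) (s : Side) : ℕ :=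
  match α p with
  | none => 0
  | some t => T.bondTo α p t s

/-- The positions occupied by a configuration. -/
def support (α : T.Assembly) : Set (ℤ × ℤ) := {p | α p ≠ none}

/-- A configuration is stable if every cut of it into two nonempty parts severs bonds of total
strength at least 2. (The edges of a cut are listed from the side of `A`, each once.) -/
def Stable (α : T.Assembly) : Prop :=
  ∀ A : Set (ℤ × ℤ), A ⊆ T.support α → A.Nonempty → (T.support α \ A).Nonempty →
    ∃ F : Finset ((ℤ × ℤ) × Side),
      (∀ e ∈ F, e.1 ∈ A ∧ e.1 + e.2.vec ∉ A) ∧ 2 ≤ ∑ e ∈ F, T.bondAt α e.1 e.2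

/-- The single-tile additions that are possible at `α`: an empty position, and a tile type that
binds there with strength at least 2. -/
def attachments (α : T.Assembly) : Set ((ℤ × ℤ) × T.Tile) :=
  {a | α a.1 = none ∧ 2 ≤ T.strength α a.1 a.2}

/-- The configuration after a single-tile addition. -/
def attach (α : T.Assembly) (a : (ℤ × ℤ) × T.Tile) : T.Assembly :=
  Function.update α a.1 (some a.2)

/-- `T.Produces α β`: there is a (finite, error-free) assembly sequence from `α` to `β`. -/
def Produces : T.Assembly → T.Assembly → Prop :=
  Relation.ReflTransGen fun α β => ∃ a ∈ T.attachments α, β = T.attach α a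

/-- No tile can be stably added. -/
def Terminal (α : T.Assembly) : Prop := T.attachments α = ∅

open Classical in
/-- The probability that the random assembly process started at `α`, in which each addition is
drawn uniformly from all currently possible single-tile additions, meets the set `G` of
configurations within its first `n` additions. (At a terminal configuration the process stays
where it is; at a finite configuration there are finitely many possible additions.) -/
noncomputable def hitProb (G : Set T.Assembly) : ℕ → T.Assembly → ℝ
  | 0, α => if α ∈ G then 1 else 0
  | n + 1, α =>
    if α ∈ G then 1
    else (∑ᶠ a ∈ T.attachments α, hitProb G n (T.attach α a)) / (T.attachments α).ncard

/-- With probability one the random assembly process started at `α` eventually meets `G`. -/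
def AlmostSurelyMeets (α : T.Assembly) (G : Set T.Assembly) : Prop :=
  Filter.Tendsto (fun n => T.hitProb G n α) Filter.atTop (nhds 1)

/-- Finite configurations admit finitely many single-tile additions. -/
theorem attachments_finite (α : T.Assembly) (hα : (T.support α).Finite) :
    (T.attachments α).Finite := by
  classical
  have := T.finite_tile
  have key : T.attachments α ⊆
      (⋃ s ∈ ({.north, .south, .east, .west} : Set Side),
        (fun q => q - s.vec) '' T.support α) ×ˢ (Set.univ : Set T.Tile) := by
    rintro ⟨p, t⟩ ⟨-, h⟩
    refine ⟨?_, trivial⟩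
    by_contra hp
    have hz : ∀ s : Side, T.bondTo α p t s = 0 := by
      intro s
      have hs : α (p + s.vec) = none := by
        by_contra hne
        exact hp (Set.mem_biUnion (x := s) (by cases s <;> simp) ⟨p + s.vec, hne, by simp⟩)
      simp [bondTo, hs]
    simp [strength, hz] at h
  refine Set.Finite.subset (Set.Finite.prod ?_ Set.finite_univ) key
  exact Set.Finite.biUnion (by simp) fun s _ => hα.image _

end TileData

/-- A tile assembly system of temperature 2 in the plane: the seed assembly is finite, nonempty
and stable. -/
structure TileSystem extends TileData where
  seed_finite : (toTileData.support seed).Finite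
  seed_nonempty : (toTileData.support seed).Nonempty
  seed_stable : toTileData.Stable seed

end TileAssembly

section DistributedSystems

/-- A crash-free distributed system as a transition system with a start configuration. `Fair`
singles out the infinite executions that the model of computation admits. -/
structure DistSystem where
  Config : Type
  Event : Type
  start : Config
  Step : Config → Event → Config → Prop
  Fair : (ℕ → Config) → (ℕ → Event) → Prop
  Halted : Config → Prop

namespace DistSystem

variable (S : DistSystem)

/-- There is a legal execution segment from `C` to `D`. -/
def Reaches : S.Config → S.Config → Prop :=
  Relation.ReflTransGen fun C D => ∃ φ, S.Step C φ D

/-- Upon achieving `C`, the system must eventually achieve some configuration in `𝒞`: every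
admissible infinite execution from `C` does. -/
def MustReach (C : S.Config) (𝒞 : Set S.Config) : Prop :=
  ∀ (run : ℕ → S.Config) (ev : ℕ → S.Event), run 0 = C →
    (∀ n, S.Step (run n) (ev n) (run (n + 1))) → S.Fair run ev → ∃ n, run n ∈ 𝒞

/-- The last configuration of a trace (latest entry first) that begins at the start
configuration. -/
def last : List (S.Event × S.Config) → S.Config
  | [] => S.start
  | (_, C) :: _ => C

/-- Each entry of the trace results from the configuration before it by a legal event. -/
def Legal : List (S.Event × S.Config) → Prop
  | [] => True
  | (φ, C) :: l => S.Step (S.last l) φ C ∧ Legal l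

/-- A configuration at a point of an execution: a reached configuration, together with the
execution from the start that has led to it. -/
structure History where
  trace : List (S.Event × S.Config)
  legal : S.Legal trace

/-- The configuration that has been reached. -/
def History.current {S : DistSystem} (H : S.History) : S.Config := S.last H.trace

/-- The same system, each configuration remembering the execution that has led to it. -/
def unfold : DistSystem where
  Config := S.History
  Event := S.Event
  start := ⟨[], trivial⟩
  Step := fun H φ H' => H'.trace = (φ, H'.current) :: H.trace
  Fair := fun run ev => S.Fair (fun n => (run n).current) ev
  Halted := fun H => S.Halted H.current

end DistSystem

/-- The tile assembly system `T` simulates the crash-free distributed system `S` through `h`. -/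
structure Simulates (T : TileSystem) (S : DistSystem) (h : S.Config → T.Assembly) : Prop where
  /-- Configurations correspond one-to-one to stable tile configurations ... -/
  injective : Function.Injective h
  stable : ∀ C, T.Stable (h C)
  /-- ... and the seed represents the start configuration. -/
  seed : h S.start = T.seed
  /-- Every legal event is modelled by a legal assembly sequence (so that an execution segment
  is modelled by the concatenation of such sequences). -/
  models : ∀ C φ D, S.Step C φ D → T.Produces (h C) (h D)
  /-- Without a legal execution segment there is no legal assembly sequence. -/
  reflects : ∀ C D, ¬ S.Reaches C D → ¬ T.Produces (h C) (h D)
  /-- What the system must eventually achieve from `C`, random assembly from `h C` achieves with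
  probability one. -/
  progress : ∀ (C : S.Config) (𝒞 : Set S.Config), S.MustReach C 𝒞 →
    T.AlmostSurelyMeets (h C) (h '' 𝒞)
  /-- When all processes have halted, assembly has ended. -/
  halted : ∀ C, S.Halted C → T.Terminal (h C)

/-- An asynchronous message-passing system of two processes (named `false` and `true`) which
exchange messages from a finite set. Each process is a deterministic Turing machine with a
two-way infinite tape. In one computation step it depends on its control state, the scanned
symbol and the oldest message in its inbuffer (`none` if there is no such message); it enters a
new control state, writes a symbol, moves its head by at most one cell and may send one message
to the other process, unless it halts (value `none`). The two processes may have entirely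
different programs and initial tapes. -/
structure MessagePassing where
  Msg : Type
  State : Type
  Symbol : Type
  finite_msg : Finite Msg
  finite_state : Finite State
  finite_symbol : Finite Symbol
  /-- The default symbol is the blank. -/
  inhabited_symbol : Inhabited Symbol
  program : Bool → State → Symbol → Option Msg →
    Option (State × Symbol × Option Turing.Dir × Option Msg)
  initState : Bool → State
  initTape : Bool → Turing.Tape Symbol

attribute [instance] MessagePassing.inhabited_symbol

namespace MessagePassing

variable (M : MessagePassing)

/-- A configuration: control states, tapes with heads, inbuffers (oldest message first), and for
each process the messages that have been sent to it but not yet delivered. -/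
structure Config where
  state : Bool → M.State
  tape : Bool → Turing.Tape M.Symbol
  inbuf : Bool → List M.Msg
  transit : Bool → Multiset M.Msg

/-- An event: a computation step of a process, or the delivery of a message to the inbuffer of a
process. -/
inductive Event : Type
  | comp (i : Bool)
  | deliver (i : Bool) (m : M.Msg)

/-- What process `i` does in configuration `C`; `none` if it has halted. -/
def action (C : M.Config) (i : Bool) :
    Option (M.State × M.Symbol × Option Turing.Dir × Option M.Msg) :=
  M.program i (C.state i) (C.tape i).head (C.inbuf i).head?

/-- Write a symbol, then move the head. -/
def act (t : Turing.Tape M.Symbol) (a : M.Symbol) (d : Option Turing.Dir) :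
    Turing.Tape M.Symbol :=
  match d with
  | none => t.write a
  | some d => (t.write a).move d

/-- The messages in transit after an optional message has been added. -/
def post (s : Multiset M.Msg) (o : Option M.Msg) : Multiset M.Msg :=
  match o with
  | none => s
  | some m => m ::ₘ s

/-- The transitions. Messages in transit may be delivered in any order. -/
inductive Step : M.Config → M.Event → M.Config → Prop
  | comp (C : M.Config) (i : Bool) (q : M.State) (a : M.Symbol) (d : Option Turing.Dir)
      (o : Option M.Msg) (h : M.action C i = some (q, a, d, o)) :
      Step C (.comp i)
        { state := Function.update C.state i q
          tape := Function.update C.tape i (M.act (C.tape i) a d)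
          inbuf := Function.update C.inbuf i (C.inbuf i).tail
          transit := Function.update C.transit (!i) (M.post (C.transit (!i)) o) }
  | deliver (C : M.Config) (i : Bool) (m : M.Msg) (s : Multiset M.Msg)
      (h : C.transit i = m ::ₘ s) :
      Step C (.deliver i m)
        { state := C.state
          tape := C.tape
          inbuf := Function.update C.inbuf i (C.inbuf i ++ [m])
          transit := Function.update C.transit i s }

/-- The distributed system. Asynchrony: the infinite executions admitted are those in which each
process takes infinitely many steps and each message in transit is eventually delivered; there is
no bound on delays. -/
def system : DistSystem where
  Config := M.Config
  Event := M.Event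
  start :=
    { state := M.initState
      tape := M.initTape
      inbuf := fun _ => []
      transit := fun _ => 0 }
  Step := M.Step
  Fair := fun run ev =>
    (∀ (i : Bool) (n : ℕ), ∃ k ≥ n, ev k = .comp i) ∧
    (∀ (i : Bool) (m : M.Msg) (n : ℕ), m ∈ (run n).transit i → ∃ k ≥ n, ev k = .deliver i m)
  Halted := fun C => ∀ i, M.action C i = none

/-- Each process runs forever: in no reachable configuration has a process halted. -/
def RunsForever : Prop :=
  ∀ C, M.system.Reaches M.system.start C → ∀ i, M.action C i ≠ none

/-- The control state and the scanned symbol of each process. -/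
def view (C : M.Config) (i : Bool) : M.State × M.Symbol := (C.state i, (C.tape i).head)

/-- The tiles record the execution: some tile types carry a mark, consisting of an event and of a
control state and a scanned symbol for each process; and of the tiles that model an event,
exactly one is marked, namely with that event and the control states and scanned symbols that
result from it. -/
def Records (T : TileSystem) (h : M.system.unfold.Config → T.Assembly) : Prop :=
  ∃ mark : T.Tile → Option (M.Event × (Bool → M.State × M.Symbol)),
    ∀ (H : M.system.History) (φ : M.Event) (H' : M.system.History),
      M.system.unfold.Step H φ H' →
        ∃ p : ℤ × ℤ,
          (h H p = none ∧
            ∃ t, h H' p = some t ∧ mark t = some (φ, M.view H'.current)) ∧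
          ∀ (p' : ℤ × ℤ) (t' : T.Tile), h H p' = none → h H' p' = some t' →
            mark t' ≠ none → p' = p

end MessagePassing

end DistributedSystems

/-! The assembly grows upwards from a seed row, two rows of tiles per event. A row of cells stores
all unbounded data of a configuration: the half tapes beside each head are stacks, the inbuffers are
queues, the messages in transit are multisets, all interleaved. Every event appends one cell at the
right end, and what it pushes or sends goes there. A sweep to the right removes the leftmost message
that the event consumes; the sweep back to the left pops the rightmost symbol of a half tape and
collects the set of messages in transit. Thus one event is one double sweep of a finite-state
machine (`Represents.step`). The control states, the scanned symbols and the set of messages in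
transit are finite information that determines which events are possible, and it arrives at the left
end, where the next event is chosen.

Each side of a tile sends a signal, needs one, or is idle, and the needs of a tile have total
strength at most 2. So a tile attaches only where all its needs are met (`mem_attachments_iff`).
There is always a single active site (`Live`), and growth there is forced except at a control
signal, where exactly one tile fits per enabled event (`Ready.attachments_eq`, `Ready.block_spec`).
The tile of each choice stays in place for ever and names its event; hence the word of events can be
read off, and one configuration extends another only if the corresponding word does
(`suffix_of_sub`). This yields injectivity and excludes illegal growth.

For the probabilistic claim let `f` be the probability of never meeting the target. It is at most
its average over the next histories. If a possible event could not be carried out with `f` remaining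
positive, every further choice would shrink the upper bound on `f` by a fixed factor below 1, so `f`
could not be positive (`exists_posStep_event`). Serving all events in turn produces a fair run with
`f` positive throughout (`exists_fair_run`). Such a run avoids the target, which is impossible if
every admissible run meets it. -/

namespace Side

instance : DecidableEq Side := fun a b => by
  cases a <;> cases b <;> first | exact isTrue rfl | exact isFalse nofun

instance : Fintype Side := ⟨{.north, .south, .east, .west}, by intro x; cases x <;> simp⟩

@[simp] theorem opp_opp (s : Side) : s.opp.opp = s := by cases s <;> rfl

@[simp] theorem vec_opp (s : Side) : s.opp.vec = -s.vec := by cases s <;> rfl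

theorem vec_ne_zero (s : Side) : s.vec ≠ 0 := by cases s <;> simp [vec]

theorem sum_univ (f : Side → ℕ) :
    ∑ s, f s = f .north + f .south + f .east + f .west := by
  change ∑ s ∈ ({.north, .south, .east, .west} : Finset Side), f s = _
  simp [add_assoc]

end Side

/-! ### Stability, forced growth and hitting probabilities in any tile assembly system -/

namespace TileData

variable {T : TileData}

/-! ### Growth and stability -/

/-- `α` is a part of `β`. -/
def Sub (α β : T.Assembly) : Prop := ∀ p t, α p = some t → β p = some t

theorem Sub.refl (α : T.Assembly) : Sub α α := fun _ _ h => h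

theorem Sub.trans {α β γ : T.Assembly} (h : Sub α β) (h' : Sub β γ) : Sub α γ :=
  fun p t hp => h' p t (h p t hp)

theorem sub_attach {α : T.Assembly} {a : (ℤ × ℤ) × T.Tile} (ha : α a.1 = none) :
    Sub α (T.attach α a) := by
  intro p t hp
  have : p ≠ a.1 := by rintro rfl; simp [ha] at hp
  simp [attach, this, hp]

theorem Produces.sub {α β : T.Assembly} (h : T.Produces α β) : Sub α β := by
  induction h with
  | refl => exact Sub.refl _
  | tail _ hs ih =>
    obtain ⟨a, ha, rfl⟩ := hs
    exact ih.trans (sub_attach ha.1)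

theorem bond_comm (t : T.Tile) (s : Side) (u : T.Tile) : T.bond t s u = T.bond u s.opp t := by
  unfold bond
  rw [Side.opp_opp]
  have : T.binds (T.glue t s).1 (T.glue u s.opp).1 ↔ T.binds (T.glue u s.opp).1 (T.glue t s).1 :=
    ⟨T.binds_symm _ _, T.binds_symm _ _⟩
  by_cases h : T.binds (T.glue u s.opp).1 (T.glue t s).1 ∧ (T.glue u s.opp).2 = (T.glue t s).2
  · rw [if_pos ⟨this.2 h.1, h.2.symm⟩, if_pos h, h.2]
  · rw [if_neg (fun h' => h ⟨this.1 h'.1, h'.2.symm⟩), if_neg h]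

theorem bondTo_mono {α β : T.Assembly} (h : Sub α β) (p : ℤ × ℤ) (t : T.Tile) (s : Side) :
    T.bondTo α p t s ≤ T.bondTo β p t s := by
  unfold bondTo
  cases hp : α (p + s.vec) with
  | none => simp
  | some u => simp [h _ _ hp]

theorem bondAt_mono {α β : T.Assembly} (h : Sub α β) (p : ℤ × ℤ) (s : Side) :
    T.bondAt α p s ≤ T.bondAt β p s := by
  unfold bondAt
  cases hp : α p with
  | none => simp
  | some u => simpa [h _ _ hp] using bondTo_mono h p u s

theorem strength_eq_sum (α : T.Assembly) (p : ℤ × ℤ) (t : T.Tile) :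
    T.strength α p t = ∑ s, T.bondTo α p t s := by
  rw [Side.sum_univ]; rfl

/-- A cut of the enlarged configuration either isolates the new tile, and then severs all its bonds,
or induces a cut of the old configuration, whose bonds persist. -/
theorem Stable.attach {α : T.Assembly} (hα : T.Stable α) {a : (ℤ × ℤ) × T.Tile}
    (ha : a ∈ T.attachments α) : T.Stable (T.attach α a) := by
  classical
  obtain ⟨p, t⟩ := a
  obtain ⟨hp, hst⟩ := ha
  simp only at hp hst
  have hsub : Sub α (T.attach α (p, t)) := sub_attach hp
  have hpt : T.attach α (p, t) p = some t := by simp [TileData.attach]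
  have hsupp : ∀ x, x ∈ T.support (T.attach α (p, t)) ↔ x = p ∨ x ∈ T.support α := by
    intro x
    by_cases hx : x = p <;> simp [support, TileData.attach, Function.update_apply, hx]
  rw [strength_eq_sum] at hst
  have hne : ∀ s : Side, p + s.vec ≠ p := fun s h => s.vec_ne_zero (by simpa using h)
  intro A hA hAne hAc
  by_cases h1 : ∀ x ∈ A, x = p
  · have hpA : p ∈ A := by
      obtain ⟨x, hx⟩ := hAne
      rwa [← h1 x hx]
    refine ⟨Finset.univ.image fun s : Side => (p, s), ?_, ?_⟩
    · intro e he
      obtain ⟨s, -, rfl⟩ := Finset.mem_image.1 he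
      exact ⟨hpA, fun h => hne s (h1 _ h)⟩
    · rw [Finset.sum_image (fun s _ s' _ h => (Prod.ext_iff.1 h).2)]
      refine hst.trans (Finset.sum_le_sum fun s _ => ?_)
      simpa [bondAt, hpt] using bondTo_mono hsub p t s
  · push Not at h1
    obtain ⟨x, hxA, hxp⟩ := h1
    by_cases h2 : T.support α ⊆ A
    · have hpA : p ∉ A := by
        obtain ⟨y, hy, hyA⟩ := hAc
        rcases (hsupp y).1 hy with rfl | hy
        · exact hyA
        · exact absurd (h2 hy) hyA
      refine ⟨(Finset.univ.filter fun s : Side => p + s.vec ∈ A).image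
        fun s : Side => (p + s.vec, s.opp), ?_, ?_⟩
      · intro e he
        obtain ⟨s, hs, rfl⟩ := Finset.mem_image.1 he
        exact ⟨(Finset.mem_filter.1 hs).2, by simpa using hpA⟩
      · rw [Finset.sum_image (fun s _ s' _ h => by
          have := congrArg (fun e => e.2.opp) h
          simpa using this), Finset.sum_filter]
        refine hst.trans (Finset.sum_le_sum fun s _ => ?_)
        cases hu : α (p + s.vec) with
        | none => simp [bondTo, hu]
        | some u =>
          rw [if_pos (h2 (by simp [support, hu]))]
          simp [bondAt, bondTo, hsub _ _ hu, hu, hpt, bond_comm t s u]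
    · obtain ⟨y, hy, hyA⟩ := Set.not_subset.1 h2
      obtain ⟨F, hF, hF2⟩ := hα (A \ {p})
        (fun z hz => ((hsupp z).1 (hA hz.1)).resolve_left hz.2) ⟨x, hxA, hxp⟩
        ⟨y, hy, fun h => hyA h.1⟩
      -- Edges into `p` need not be severed, as `p` may lie in `A`; dropping them costs nothing
      -- because `p` is empty in `α`.
      refine ⟨F.filter fun e => e.1 + e.2.vec ≠ p, ?_, ?_⟩
      · intro e he
        obtain ⟨heF, hep⟩ := Finset.mem_filter.1 he
        exact ⟨(hF e heF).1.1, fun h => (hF e heF).2 ⟨h, hep⟩⟩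
      · rw [Finset.sum_filter]
        refine hF2.trans (Finset.sum_le_sum fun e _ => ?_)
        by_cases hep : e.1 + e.2.vec = p
        · have : T.bondAt α e.1 e.2 = 0 := by
            unfold bondAt
            cases α e.1 with
            | none => rfl
            | some u => simp [bondTo, hep, hp]
          simp [this]
        · simpa [hep] using bondAt_mono hsub e.1 e.2

theorem Stable.produces {α β : T.Assembly} (hα : T.Stable α) (h : T.Produces α β) :
    T.Stable β := by
  induction h with
  | refl => exact hα
  | tail _ hs ih =>
    obtain ⟨a, ha, rfl⟩ := hs
    exact ih.attach ha

/-- The configuration after a list of single-tile additions. -/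
def attachAll (α : T.Assembly) (L : List ((ℤ × ℤ) × T.Tile)) : T.Assembly :=
  L.foldl T.attach α

@[simp] theorem attachAll_nil (α : T.Assembly) : attachAll α [] = α := rfl

@[simp] theorem attachAll_cons (α : T.Assembly) (a : (ℤ × ℤ) × T.Tile)
    (L : List ((ℤ × ℤ) × T.Tile)) : attachAll α (a :: L) = attachAll (T.attach α a) L := rfl

theorem attachAll_append (α : T.Assembly) (L L' : List ((ℤ × ℤ) × T.Tile)) :
    attachAll α (L ++ L') = attachAll (attachAll α L) L' := by
  simp [attachAll]

theorem attachAll_apply_of_notMem {α : T.Assembly} {L : List ((ℤ × ℤ) × T.Tile)} {p : ℤ × ℤ}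
    (h : ∀ a ∈ L, a.1 ≠ p) : attachAll α L p = α p := by
  induction L generalizing α with
  | nil => rfl
  | cons a L ih =>
    rw [attachAll_cons, ih fun b hb => h b (List.mem_cons_of_mem _ hb)]
    simp [attach, (h a (by simp)).symm]

theorem mem_of_attachAll_apply {α : T.Assembly} {L : List ((ℤ × ℤ) × T.Tile)} {p : ℤ × ℤ}
    {t : T.Tile} (h : attachAll α L p = some t) : α p = some t ∨ (p, t) ∈ L := by
  induction L generalizing α with
  | nil => exact Or.inl h
  | cons a L ih =>
    rcases ih h with h | h
    · by_cases hpa : p = a.1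
      · subst hpa
        have : a.2 = t := by simpa [attach] using h
        subst this
        simp
      · left
        simpa [attach, hpa] using h
    · exact Or.inr (List.mem_cons_of_mem _ h)

/-! ### Forced growth -/

/-- `β` arises from `α` by the only addition that is possible at `α`. -/
def Forced (α β : T.Assembly) : Prop := ∃ a, T.attachments α = {a} ∧ β = T.attach α a

theorem forced_attach {α : T.Assembly} {a : (ℤ × ℤ) × T.Tile} (h : T.attachments α = {a}) :
    Forced α (T.attach α a) := ⟨a, h, rfl⟩

theorem produces_of_forced {α β : T.Assembly} (h : Relation.ReflTransGen Forced α β) :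
    T.Produces α β := by
  induction h with
  | refl => exact .refl
  | tail _ hs ih =>
    obtain ⟨a, ha, rfl⟩ := hs
    exact ih.tail ⟨a, by simp [ha], rfl⟩

/-! ### The probability of meeting a set of configurations -/

theorem hitProb_nonneg (G : Set T.Assembly) (n : ℕ) (α : T.Assembly) :
    0 ≤ T.hitProb G n α := by
  induction n generalizing α with
  | zero => unfold hitProb; split_ifs <;> simp
  | succ n ih =>
    unfold hitProb
    split_ifs
    · simp
    · exact div_nonneg (finsum_nonneg fun a => finsum_nonneg fun _ => ih _) (Nat.cast_nonneg _)

theorem hitProb_le_one (G : Set T.Assembly) (n : ℕ) (α : T.Assembly) :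
    T.hitProb G n α ≤ 1 := by
  induction n generalizing α with
  | zero => unfold hitProb; split_ifs <;> simp
  | succ n ih =>
    unfold hitProb
    split_ifs
    · simp
    · by_cases hf : (T.attachments α).Finite
      · refine div_le_one_of_le₀ ?_ (Nat.cast_nonneg _)
        rw [finsum_mem_eq_finite_toFinset_sum _ hf, Set.ncard_eq_toFinset_card _ hf]
        simpa using Finset.sum_le_sum fun a (_ : a ∈ hf.toFinset) => ih (T.attach α a)
      -- Here `ncard` is 0, and division by 0 gives 0.
      · simp [Set.Infinite.ncard hf]

theorem hitProb_of_mem {G : Set T.Assembly} {α : T.Assembly} (h : α ∈ G) (n : ℕ) :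
    T.hitProb G n α = 1 := by
  cases n <;> simp [hitProb, h]

theorem hitProb_le_succ (G : Set T.Assembly) (n : ℕ) (α : T.Assembly) :
    T.hitProb G n α ≤ T.hitProb G (n + 1) α := by
  by_cases hα : α ∈ G
  · simp [hitProb_of_mem hα]
  induction n generalizing α with
  | zero =>
    have : T.hitProb G 0 α = 0 := by simp [hitProb, hα]
    rw [this]
    exact hitProb_nonneg _ _ _
  | succ n ih =>
    have ih' : ∀ β, T.hitProb G n β ≤ T.hitProb G (n + 1) β := fun β => by
      by_cases hβ : β ∈ G
      · simp [hitProb_of_mem hβ]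
      · exact ih β hβ
    rw [hitProb, hitProb, if_neg hα, if_neg hα]
    by_cases hf : (T.attachments α).Finite
    · rw [finsum_mem_eq_finite_toFinset_sum _ hf, finsum_mem_eq_finite_toFinset_sum _ hf]
      gcongr
      exact ih' _
    · simp [Set.Infinite.ncard hf]

theorem hitProb_monotone (G : Set T.Assembly) (α : T.Assembly) :
    Monotone fun n => T.hitProb G n α :=
  monotone_nat_of_le_succ fun n => hitProb_le_succ G n α

/-- The probability that random assembly started at `α` eventually meets `G`. -/
noncomputable def hit (G : Set T.Assembly) (α : T.Assembly) : ℝ := ⨆ n, T.hitProb G n α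

theorem tendsto_hitProb (G : Set T.Assembly) (α : T.Assembly) :
    Filter.Tendsto (fun n => T.hitProb G n α) Filter.atTop (nhds (hit G α)) :=
  tendsto_atTop_ciSup (hitProb_monotone G α)
    ⟨1, by rintro _ ⟨n, rfl⟩; exact hitProb_le_one G n α⟩

theorem hit_le_one (G : Set T.Assembly) (α : T.Assembly) : hit G α ≤ 1 :=
  le_of_tendsto' (tendsto_hitProb G α) fun n => hitProb_le_one G n α

theorem hit_of_mem {G : Set T.Assembly} {α : T.Assembly} (h : α ∈ G) : hit G α = 1 := by
  simp [hit, hitProb_of_mem h]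

/-- The recursion for `hitProb` passes to the limit because the sum is finite. -/
theorem hit_eq_average {G : Set T.Assembly} {α : T.Assembly} (h : α ∉ G)
    (hf : (T.attachments α).Finite) :
    hit G α = (∑ a ∈ hf.toFinset, hit G (T.attach α a)) / hf.toFinset.card := by
  refine tendsto_nhds_unique ((tendsto_hitProb G α).comp (Filter.tendsto_add_atTop_nat 1)) ?_
  have : (fun n => T.hitProb G n α) ∘ (fun n => n + 1) = fun n =>
      (∑ a ∈ hf.toFinset, T.hitProb G n (T.attach α a)) / hf.toFinset.card := by
    funext n
    simp only [Function.comp]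
    rw [hitProb, if_neg h, finsum_mem_eq_finite_toFinset_sum _ hf, Set.ncard_eq_toFinset_card _ hf]
  rw [this]
  exact (tendsto_finsetSum _ fun a _ => tendsto_hitProb G _).div_const _

/-- Outside `G` a forced addition leaves the probability unchanged. Only an inequality holds, since
the chain may pass through `G` on its way to `β`. -/
theorem hit_le_of_forced {G : Set T.Assembly} {α β : T.Assembly}
    (h : Relation.ReflTransGen Forced α β) : hit G β ≤ hit G α := by
  induction h using Relation.ReflTransGen.head_induction_on with
  | refl => exact le_rfl
  | head hs _ ih =>
    rename_i α γ _
    obtain ⟨a, ha, rfl⟩ := hs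
    by_cases hα : α ∈ G
    · rw [hit_of_mem hα]
      exact hit_le_one _ _
    · have hf : (T.attachments α).Finite := by simp [ha]
      rw [hit_eq_average hα hf]
      have : hf.toFinset = {a} := by ext; simp [ha]
      simpa [this] using ih

end TileData

/-! ### Sweep machines and their tiles -/

/-- A machine that rewrites a row of cells. It chooses an enabled event, sweeps once forward over
the row, appends a cell, and sweeps once backward. -/
structure SweepMachine where
  Ctrl : Type
  Event : Type
  Fwd : Type
  Bwd : Type
  Cell : Type
  finite_ctrl : Finite Ctrl
  finite_event : Finite Event
  finite_fwd : Finite Fwd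
  finite_bwd : Finite Bwd
  finite_cell : Finite Cell
  enabled : Ctrl → Set Event
  start : Ctrl → Event → Fwd
  fwd : Fwd → Cell → Fwd × Cell
  turn : Fwd → Bwd × Cell
  bwd : Bwd → Cell → Bwd × Cell
  finish : Bwd → Ctrl
  initCtrl : Ctrl
  initRow : List Cell

namespace SweepMachine

variable (W : SweepMachine)

/-- The forward sweep. -/
def sweepFwd : W.Fwd → List W.Cell → W.Fwd × List W.Cell
  | q, [] => (q, [])
  | q, a :: l => ((sweepFwd (W.fwd q a).1 l).1, (W.fwd q a).2 :: (sweepFwd (W.fwd q a).1 l).2)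

/-- The backward sweep, which begins at the last cell. -/
def sweepBwd : W.Bwd → List W.Cell → W.Bwd × List W.Cell
  | q, [] => (q, [])
  | q, a :: l =>
    ((W.bwd (sweepBwd q l).1 a).1, (W.bwd (sweepBwd q l).1 a).2 :: (sweepBwd q l).2)

@[simp] theorem length_sweepFwd (q : W.Fwd) (l : List W.Cell) :
    (W.sweepFwd q l).2.length = l.length := by
  induction l generalizing q with
  | nil => rfl
  | cons a l ih => simp [sweepFwd, ih]

@[simp] theorem length_sweepBwd (q : W.Bwd) (l : List W.Cell) :
    (W.sweepBwd q l).2.length = l.length := by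
  induction l with
  | nil => rfl
  | cons a l ih => simp [sweepBwd, ih]

/-- State and appended cell at the right end of the row. -/
def turned (K : W.Ctrl) (row : List W.Cell) (e : W.Event) : W.Bwd × W.Cell :=
  W.turn (W.sweepFwd (W.start K e) row).1

/-- The row before the backward sweep. -/
def midRow (K : W.Ctrl) (row : List W.Cell) (e : W.Event) : List W.Cell :=
  (W.sweepFwd (W.start K e) row).2 ++ [(W.turned K row e).2]

/-- State and row after both sweeps. -/
def swept (K : W.Ctrl) (row : List W.Cell) (e : W.Event) : W.Bwd × List W.Cell :=
  W.sweepBwd (W.turned K row e).1 (W.midRow K row e)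

/-- Control state and row after a word of events (latest first). -/
def run : List W.Event → W.Ctrl × List W.Cell
  | [] => (W.initCtrl, W.initRow)
  | e :: l => (W.finish (W.swept (run l).1 (run l).2 e).1, (W.swept (run l).1 (run l).2 e).2)

/-- Each event of the word is enabled when it occurs. -/
def Valid : List W.Event → Prop
  | [] => True
  | e :: l => e ∈ W.enabled (W.run l).1 ∧ Valid l

/-- What a tile tells its neighbour across a side. -/
inductive Signal : Type
  | ctrl (K : W.Ctrl)
  | right (q : W.Fwd)
  | corner (b : W.Bwd)
  | up (b : W.Bwd)
  | left (b : W.Bwd)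
  | link (k : ℕ)
  | cell (a : W.Cell)
  | wall
  | base

/-- The tile types. -/
inductive Tile : Type
  | seed (k : Fin (W.initRow.length + 2))
  | choice (K : W.Ctrl) (e : W.Event)
  | right (q : W.Fwd) (a : W.Cell)
  | grow (q : W.Fwd)
  | corner (b : W.Bwd)
  | turn (b : W.Bwd)
  | left (b : W.Bwd) (a : W.Cell)
  | final (b : W.Bwd)

instance : Finite W.Tile := by
  have := W.finite_ctrl
  have := W.finite_event
  have := W.finite_fwd
  have := W.finite_bwd
  have := W.finite_cell
  let f : W.Tile → Fin (W.initRow.length + 2) ⊕ (W.Ctrl × W.Event) ⊕ (W.Fwd × W.Cell) ⊕ W.Fwd ⊕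
      W.Bwd ⊕ W.Bwd ⊕ (W.Bwd × W.Cell) ⊕ W.Bwd
    | .seed k => .inl k
    | .choice K e => .inr (.inl (K, e))
    | .right q a => .inr (.inr (.inl (q, a)))
    | .grow q => .inr (.inr (.inr (.inl q)))
    | .corner b => .inr (.inr (.inr (.inr (.inl b))))
    | .turn b => .inr (.inr (.inr (.inr (.inr (.inl b)))))
    | .left b a => .inr (.inr (.inr (.inr (.inr (.inr (.inl (b, a)))))))
    | .final b => .inr (.inr (.inr (.inr (.inr (.inr (.inr b))))))
  refine Finite.of_injective f fun t t' h => ?_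
  cases t <;> cases t' <;> simp_all [f]

variable {W}

namespace Signal

/-- The strength of the bond that carries the signal. -/
def strength : W.Signal → Fin 3
  | ctrl _ | corner _ | up _ | link _ => 2
  | right _ | left _ | cell _ | wall | base => 1

/-- The signals that hand on the activity from a tile to the next one. -/
def Active : W.Signal → Prop
  | ctrl _ | corner _ | up _ | link _ | right _ | left _ => True
  | cell _ | wall | base => False

theorem strength_pos (σ : W.Signal) : 0 < (σ.strength : ℕ) := by
  cases σ <;> simp [strength]

end Signal

/-- The signal on the north side of a seed tile. -/
def seedTop (W : SweepMachine) : ℕ → W.Signal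
  | 0 => .ctrl W.initCtrl
  | k + 1 => (W.initRow[k]?).elim .wall .cell

open Classical in
/-- The signal across a side of a tile; the flag tells whether the tile sends it or needs it. -/
noncomputable def port : W.Tile → Side → Option (Bool × W.Signal)
  | .seed k, .north => some (true, W.seedTop k)
  | .seed k, .east => if (k : ℕ) ≤ W.initRow.length then some (false, .link k) else none
  | .seed k, .west => if 0 < (k : ℕ) then some (true, .link (k - 1)) else none
  | .seed _, .south => none
  | .choice K e, .south => if e ∈ W.enabled K then some (false, .ctrl K) else none
  | .choice K e, .east => some (true, .right (W.start K e))
  | .choice _ _, .north => some (true, .base)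
  | .choice _ _, .west => none
  | .right q _, .west => some (false, .right q)
  | .right _ a, .south => some (false, .cell a)
  | .right q a, .east => some (true, .right (W.fwd q a).1)
  | .right q a, .north => some (true, .cell (W.fwd q a).2)
  | .grow q, .west => some (false, .right q)
  | .grow _, .south => some (false, .wall)
  | .grow q, .east => some (true, .corner (W.turn q).1)
  | .grow q, .north => some (true, .cell (W.turn q).2)
  | .corner b, .west => some (false, .corner b)
  | .corner b, .north => some (true, .up b)
  | .corner _, .east => none
  | .corner _, .south => none
  | .turn b, .south => some (false, .up b)
  | .turn b, .west => some (true, .left b)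
  | .turn _, .north => some (true, .wall)
  | .turn _, .east => none
  | .left b _, .east => some (false, .left b)
  | .left _ a, .south => some (false, .cell a)
  | .left b a, .west => some (true, .left (W.bwd b a).1)
  | .left b a, .north => some (true, .cell (W.bwd b a).2)
  | .final b, .east => some (false, .left b)
  | .final _, .south => some (false, .base)
  | .final b, .north => some (true, .ctrl (W.finish b))
  | .final _, .west => none

/-- The part of the seed row from column `k` on. -/
def seedFrom (W : SweepMachine) (k : ℕ) : ℤ × ℤ → Option W.Tile := fun p =>
  if h : p.2 = -1 ∧ (k : ℤ) ≤ p.1 ∧ p.1 ≤ W.initRow.length + 1 then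
    some (.seed ⟨p.1.toNat, by omega⟩)
  else none

/-- The tile assembly system of the machine. -/
noncomputable abbrev tiles (W : SweepMachine) : TileData where
  Tile := W.Tile
  Glue := Option (Bool × W.Signal)
  finite_tile := inferInstance
  glue := fun t s => (port t s, (port t s).elim 0 fun x => x.2.strength)
  binds := fun g g' => ∃ b σ, g = some (b, σ) ∧ g' = some (!b, σ)
  binds_symm := by
    rintro _ _ ⟨b, σ, rfl, rfl⟩
    exact ⟨!b, σ, rfl, by simp⟩
  seed := W.seedFrom 0

open TileData

/-- The configuration has a tile at `p` which sends `σ` across its side `s`. -/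
def Sends (α : W.tiles.Assembly) (p : ℤ × ℤ) (s : Side) (σ : W.Signal) : Prop :=
  ∃ u : W.Tile, α p = some u ∧ port u s = some (true, σ)

theorem Sends.mono {α β : W.tiles.Assembly} {p : ℤ × ℤ} {s : Side} {σ : W.Signal}
    (h : Sends α p s σ) (hs : Sub α β) : Sends β p s σ := by
  obtain ⟨u, hu, hp⟩ := h
  exact ⟨u, hs _ _ hu, hp⟩

theorem Sends.unique {α : W.tiles.Assembly} {p : ℤ × ℤ} {s : Side} {σ σ' : W.Signal}
    (h : Sends α p s σ) (h' : Sends α p s σ') : σ = σ' := by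
  obtain ⟨u, hu, hp⟩ := h
  obtain ⟨u', hu', hp'⟩ := h'
  obtain rfl : u = u' := Option.some_injective _ (hu.symm.trans hu')
  simpa [hp] using hp'

theorem bond_of_port {t u : W.tiles.Tile} {s : Side} {b : Bool} {σ : W.Signal}
    (ht : port t s = some (b, σ)) (hu : port u s.opp = some (!b, σ)) :
    W.tiles.bond t s u = σ.strength := by
  unfold bond
  rw [if_pos]
  · simp [ht]
  · exact ⟨⟨b, σ, ht, hu⟩, by simp [ht, hu]⟩

theorem port_of_bond_ne_zero {t u : W.tiles.Tile} {s : Side} (h : W.tiles.bond t s u ≠ 0) :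
    ∃ b σ, port t s = some (b, σ) ∧ port u s.opp = some (!b, σ) := by
  unfold bond at h
  split_ifs at h with h'
  · exact h'.1
  · exact absurd rfl h

/-- The strength of the signal that the tile needs across the side. -/
noncomputable def need (t : W.Tile) (s : Side) : ℕ :=
  match port t s with
  | some (false, σ) => σ.strength
  | _ => 0

theorem need_of_port {t : W.Tile} {s : Side} {σ : W.Signal} (h : port t s = some (false, σ)) :
    need t s = σ.strength := by
  simp [need, h]

/-- A tile needs one signal of strength 2, or two of strength 1, or nothing. The last case includes
the choice of a disabled event, which therefore never finds support. -/
theorem sum_need_le (t : W.Tile) : ∑ s, need t s ≤ 2 := by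
  rw [Side.sum_univ]
  cases t <;> simp [need, port, Signal.strength]
  all_goals split_ifs <;> simp

/-- No tile needs more than one passive signal, and passive signals have strength 1; so they alone
cannot hold a tile. -/
theorem exists_active_of_sum_need {t : W.Tile} (h : ∑ s, need t s = 2) :
    ∃ s σ, port t s = some (false, σ) ∧ σ.Active := by
  rw [Side.sum_univ] at h
  cases t with
  | seed k =>
    by_cases hk : (k : ℕ) ≤ W.initRow.length
    · exact ⟨.east, _, if_pos hk, trivial⟩
    · simp [need, port, hk] at h
  | choice K e =>
    by_cases hk : e ∈ W.enabled K
    · exact ⟨.south, _, if_pos hk, trivial⟩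
    · simp [need, port, hk] at h
  | right q a => exact ⟨.west, _, rfl, trivial⟩
  | grow q => exact ⟨.west, _, rfl, trivial⟩
  | corner b => exact ⟨.west, _, rfl, trivial⟩
  | turn b => exact ⟨.south, _, rfl, trivial⟩
  | left b a => exact ⟨.east, _, rfl, trivial⟩
  | final b => exact ⟨.east, _, rfl, trivial⟩

theorem sum_need_of_active {t : W.Tile} {s : Side} {σ : W.Signal}
    (h : port t s = some (false, σ)) (hσ : σ.Active) : ∑ s, need t s = 2 := by
  rw [Side.sum_univ]
  cases σ <;> simp only [Signal.Active] at hσ <;> cases t <;> cases s <;> simp [port] at h <;>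
    simp [need, port, Signal.strength, h]
  · rw [if_pos h.1]
    rfl
  · rw [if_pos (h.2 ▸ h.1)]
    rfl

theorem seedTop_succ_not_active (k : ℕ) : ¬ (W.seedTop (k + 1)).Active := by
  change ¬ ((W.initRow[k]?).elim Signal.wall Signal.cell).Active
  cases W.initRow[k]? <;> exact id

/-- This keeps growth from branching into parallel fronts. -/
theorem active_out_unique {t : W.Tile} {s s' : Side} {σ σ' : W.Signal}
    (h : port t s = some (true, σ)) (hσ : σ.Active)
    (h' : port t s' = some (true, σ')) (hσ' : σ'.Active) : s = s' := by
  have hseed := seedTop_succ_not_active (W := W)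
  cases t with
  | seed k =>
    obtain ⟨k, hk⟩ := k
    cases k with
    | zero =>
      cases s <;> simp [port] at h
      cases s' <;> simp [port] at h'
      rfl
    | succ k =>
      cases s <;> simp [port] at h <;> cases s' <;> simp [port] at h'
      all_goals
        first | rfl | (subst h; exact absurd hσ (hseed k)) | (subst h'; exact absurd hσ' (hseed k))
  | _ =>
    cases s <;> simp [port] at h <;> cases s' <;> simp [port] at h' <;>
      first | rfl | (subst h; exact hσ.elim) | (subst h'; exact hσ'.elim)

/-- The active signal leaves open only what stands below: a cell, the wall or the base, and that is
settled by the south side. A control signal is exempt, as it admits one tile per enabled event. -/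
theorem eq_of_port {t t' : W.Tile} {s : Side} {σ : W.Signal}
    (h : port t s = some (false, σ)) (h' : port t' s = some (false, σ)) (hσ : σ.Active)
    (hK : ∀ K, σ ≠ .ctrl K)
    (hS : ∀ τ τ', port t .south = some (false, τ) → port t' .south = some (false, τ') → τ = τ') :
    t = t' := by
  cases σ <;> simp only [Signal.Active] at hσ
  case ctrl K => exact absurd rfl (hK K)
  all_goals
    cases t <;> cases s <;> simp [port] at h <;> cases t' <;> simp [port] at h'
    all_goals simp_all [port, Fin.ext_iff]

end SweepMachine

/-! ### The active site and the growth of sweeps -/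

namespace SweepMachine

open TileData

variable {W : SweepMachine}

/-- Each signal that a tile of the configuration needs comes from a position that is occupied. -/
def Closed (α : W.tiles.Assembly) : Prop :=
  ∀ p (t : W.Tile) s σ, α p = some t → port t s = some (false, σ) → α (p + s.vec) ≠ none

/-- No tile of a closed configuration waits for a signal from an empty position. So a sending side
of the new tile finds no partner, and only its needs contribute. -/
theorem bondTo_le_need {α : W.tiles.Assembly} (hα : Closed α) {p : ℤ × ℤ} (hp : α p = none)
    (t : W.Tile) (s : Side) : W.tiles.bondTo α p t s ≤ need t s ∧
      (W.tiles.bondTo α p t s ≠ 0 → ∀ σ, port t s = some (false, σ) →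
        Sends α (p + s.vec) s.opp σ) := by
  unfold bondTo
  cases hu : α (p + s.vec) with
  | none => simp
  | some u =>
    by_cases h0 : W.tiles.bond t s u = 0
    · simp [h0]
    · obtain ⟨b, σ, ht, hu'⟩ := port_of_bond_ne_zero h0
      cases b with
      | true =>
        exact absurd (by simpa using hp) (hα _ _ _ _ hu hu')
      | false =>
        refine ⟨?_, fun _ σ' hσ' => ⟨u, hu, ?_⟩⟩
        · simp only
          rw [bond_of_port ht hu', need_of_port ht]
        · obtain rfl : σ = σ' := by
            have : some (false, σ) = some (false, σ') := ht.symm.trans hσ'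
            simpa using this
          exact hu'

theorem need_le_bondTo {α : W.tiles.Assembly} {p : ℤ × ℤ} {t : W.Tile} {s : Side}
    (h : ∀ σ, port t s = some (false, σ) → Sends α (p + s.vec) s.opp σ) :
    need t s ≤ W.tiles.bondTo α p t s := by
  unfold need
  split
  · rename_i σ hσ
    obtain ⟨u, hu, hp⟩ := h σ hσ
    simp only [bondTo, hu]
    rw [bond_of_port hσ hp]
  · simp

/-- A tile can be added exactly where all signals that it needs are sent to it. -/
theorem mem_attachments_iff {α : W.tiles.Assembly} (hα : Closed α) {p : ℤ × ℤ} {t : W.Tile} :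
    ((p, t) : (ℤ × ℤ) × W.tiles.Tile) ∈ W.tiles.attachments α ↔ α p = none ∧ ∑ s, need t s = 2 ∧
      ∀ s σ, port t s = some (false, σ) → Sends α (p + s.vec) s.opp σ := by
  constructor
  · rintro ⟨hp, h2⟩
    rw [strength_eq_sum] at h2
    simp only at hp h2
    have hle := fun s => bondTo_le_need hα hp t s
    have hsum := Finset.sum_le_sum (s := Finset.univ) fun s _ => (hle s).1
    have hn := sum_need_le t
    -- The chain 2 ≤ strength ≤ total need ≤ 2 forces equality on every side.
    have heq := (Finset.sum_eq_sum_iff_of_le (s := Finset.univ) fun s _ => (hle s).1).1 (by omega)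
    refine ⟨hp, by omega, fun s σ hσ => (hle s).2 ?_ σ hσ⟩
    rw [heq s (Finset.mem_univ _), need_of_port hσ]
    exact σ.strength_pos.ne'
  · rintro ⟨hp, h2, h⟩
    refine ⟨hp, ?_⟩
    rw [strength_eq_sum]
    exact h2.symm.le.trans (Finset.sum_le_sum fun s _ => need_le_bondTo (h s))

/-- The configuration is active only at the empty position `z`, which is sent the signal `σ` from
its side `s`. -/
structure Live (α : W.tiles.Assembly) (z : ℤ × ℤ) (s : Side) (σ : W.Signal) : Prop where
  closed : Closed α
  only : ∀ p (t : W.Tile) s' σ', α p = some t → port t s' = some (true, σ') → σ'.Active →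
    α (p + s'.vec) = none → p + s'.vec = z ∧ s'.opp = s ∧ σ' = σ
  empty : α z = none
  sends : Sends α (z + s.vec) s.opp σ
  active : σ.Active

namespace Live

variable {α : W.tiles.Assembly} {z : ℤ × ℤ} {s : Side} {σ : W.Signal}

/-- Any tile that attaches has an active need, and `only` leaves `z` as the one empty position to
which an active signal is sent. -/
theorem mem_attachments_iff (h : Live α z s σ) {p : ℤ × ℤ} {t : W.Tile} :
    ((p, t) : (ℤ × ℤ) × W.tiles.Tile) ∈ W.tiles.attachments α ↔ p = z ∧ port t s = some (false, σ) ∧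
      ∀ s σ, port t s = some (false, σ) → Sends α (z + s.vec) s.opp σ := by
  rw [SweepMachine.mem_attachments_iff h.closed]
  constructor
  · rintro ⟨hp, h2, hs⟩
    obtain ⟨s', σ', ht, hσ'⟩ := exists_active_of_sum_need h2
    obtain ⟨u, hu, hu'⟩ := hs _ _ ht
    have := h.only _ _ _ _ hu hu' hσ' (by simpa using hp)
    simp only [Side.vec_opp, Side.opp_opp, add_neg_cancel_right] at this
    obtain ⟨rfl, rfl, rfl⟩ := this
    exact ⟨rfl, ht, hs⟩
  · rintro ⟨rfl, ht, hs⟩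
    exact ⟨h.empty, sum_need_of_active ht h.active, hs⟩

theorem attachments_eq (h : Live α z s σ) (hK : ∀ K, σ ≠ .ctrl K) {t : W.Tile}
    (ht : port t s = some (false, σ))
    (hs : ∀ s σ, port t s = some (false, σ) → Sends α (z + s.vec) s.opp σ) :
    W.tiles.attachments α = {(z, t)} := by
  ext ⟨p, t'⟩
  rw [h.mem_attachments_iff, Set.mem_singleton_iff]
  constructor
  · rintro ⟨rfl, ht', hs'⟩
    rw [eq_of_port ht' ht h.active hK fun τ τ' hτ hτ' => (hs' _ _ hτ).unique (hs _ _ hτ')]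
  · intro h'
    obtain ⟨rfl, rfl⟩ := Prod.ext_iff.1 h'
    exact ⟨rfl, ht, hs⟩

/-- The new tile uses up the only pending active signal and emits exactly one of its own. Its needs
are met by tiles already present, so closedness survives. -/
theorem attach (h : Live α z s σ) {t : W.Tile}
    (hs : ∀ s σ, port t s = some (false, σ) → Sends α (z + s.vec) s.opp σ)
    {s' s'' : Side} {σ' : W.Signal} {z' : ℤ × ℤ} (ht : port t s' = some (true, σ'))
    (hσ' : σ'.Active) (hz : α z' = none) (ez : z + s'.vec = z') (es : s'.opp = s'') :
    Live (W.tiles.attach α (z, t)) z' s'' σ' := by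
  subst ez es
  have hsub : Sub α (W.tiles.attach α (z, t)) := sub_attach h.empty
  have hzt : W.tiles.attach α (z, t) z = some t := by simp [TileData.attach]
  have hne : z + s'.vec ≠ z := fun e => s'.vec_ne_zero (by simpa using e)
  have hold : ∀ p, p ≠ z → W.tiles.attach α (z, t) p = α p := fun p hp => by
    simp [TileData.attach, hp]
  have hocc : ∀ p, α p ≠ none → W.tiles.attach α (z, t) p ≠ none := fun p hp => by
    obtain ⟨u, hu⟩ := Option.ne_none_iff_exists'.1 hp
    simp [hsub _ _ hu]
  refine ⟨?_, ?_, ?_, ⟨t, by simpa using hzt, by simpa using ht⟩, hσ'⟩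
  · intro p u s₁ σ₁ hp hu
    by_cases hpz : p = z
    · subst hpz
      obtain rfl : t = u := Option.some_injective _ (hzt.symm.trans hp)
      obtain ⟨v, hv, -⟩ := hs _ _ hu
      exact hocc _ (by simp [hv])
    · rw [hold p hpz] at hp
      exact hocc _ (h.closed _ _ _ _ hp hu)
  · intro p u s₁ σ₁ hp hu hσ₁ he
    by_cases hpz : p = z
    · subst hpz
      obtain rfl : t = u := Option.some_injective _ (hzt.symm.trans hp)
      obtain rfl := active_out_unique ht hσ' hu hσ₁
      refine ⟨rfl, rfl, ?_⟩
      have : some (true, σ') = some (true, σ₁) := ht.symm.trans hu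
      simpa using this.symm
    · rw [hold p hpz] at hp
      have hnone : α (p + s₁.vec) = none := by
        by_contra hc
        exact hocc _ hc he
      obtain ⟨hz', -, -⟩ := h.only _ _ _ _ hp hu hσ₁ hnone
      rw [hz', hzt] at he
      simp at he
  · rw [hold _ hne, hz]

/-- The forced addition of a tile that hands on the activity. -/
theorem step (h : Live α z s σ) (hK : ∀ K, σ ≠ .ctrl K) {t : W.Tile}
    (ht : port t s = some (false, σ))
    (hs : ∀ s σ, port t s = some (false, σ) → Sends α (z + s.vec) s.opp σ)
    {s' s'' : Side} {σ' : W.Signal} {z' : ℤ × ℤ} (ht' : port t s' = some (true, σ'))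
    (hσ' : σ'.Active) (hz : α z' = none) (ez : z + s'.vec = z') (es : s'.opp = s'') :
    Forced α (W.tiles.attach α (z, t)) ∧ Live (W.tiles.attach α (z, t)) z' s'' σ' :=
  ⟨forced_attach (h.attachments_eq hK ht hs), h.attach hs ht' hσ' hz ez es⟩

end Live

/-! ### Sweeps -/

/-- The tiles in row `y` from column `x` on send the cells of a list to the north. -/
def RowAt (α : W.tiles.Assembly) (y : ℤ) : ℤ → List W.Cell → Prop
  | _, [] => True
  | x, a :: l => Sends α (x, y) .north (.cell a) ∧ RowAt α y (x + 1) l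

theorem RowAt.mono {α β : W.tiles.Assembly} (hs : Sub α β) {y x : ℤ} {l : List W.Cell}
    (h : RowAt α y x l) : RowAt β y x l := by
  induction l generalizing x with
  | nil => trivial
  | cons a l ih => exact ⟨h.1.mono hs, ih h.2⟩

theorem rowAt_append {α : W.tiles.Assembly} {y x : ℤ} {l l' : List W.Cell} :
    RowAt α y x (l ++ l') ↔ RowAt α y x l ∧ RowAt α y (x + l.length) l' := by
  induction l generalizing x with
  | nil => simp [RowAt]
  | cons a l ih => simp [RowAt, ih, and_assoc, add_assoc, add_comm (1 : ℤ)]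

theorem sends_attach {α : W.tiles.Assembly} {z : ℤ × ℤ} {t : W.Tile} {s : Side} {σ : W.Signal}
    (h : port t s = some (true, σ)) : Sends (W.tiles.attach α (z, t)) z s σ :=
  ⟨t, by simp [TileData.attach], h⟩

theorem sub_of_forced {α β : W.tiles.Assembly} (h : Relation.ReflTransGen Forced α β) :
    Sub α β := (produces_of_forced h).sub

variable (W) in
/-- The tiles of a forward sweep in row `y` from column `x` on. -/
def fwdTiles (y : ℤ) : ℤ → W.Fwd → List W.Cell → List ((ℤ × ℤ) × W.tiles.Tile)
  | _, _, [] => []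
  | x, q, a :: l => ((x, y), (Tile.right q a : W.Tile)) :: fwdTiles y (x + 1) (W.fwd q a).1 l

variable (W) in
/-- The tiles of a backward sweep in row `y` from column `x` on. -/
def bwdTiles (y : ℤ) : ℤ → W.Bwd → List W.Cell → List ((ℤ × ℤ) × W.tiles.Tile)
  | _, _, [] => []
  | x, b, a :: l =>
    bwdTiles y (x + 1) b l ++ [((x, y), (Tile.left (W.sweepBwd b l).1 a : W.Tile))]

theorem mem_fwdTiles {y x : ℤ} {q : W.Fwd} {l : List W.Cell} {p : ℤ × ℤ} {t : W.tiles.Tile}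
    (h : (p, t) ∈ W.fwdTiles y x q l) :
    p.2 = y ∧ x ≤ p.1 ∧ p.1 < x + l.length ∧ ∃ q' a, t = (Tile.right q' a : W.Tile) := by
  induction l generalizing x q with
  | nil => simp [fwdTiles] at h
  | cons a l ih =>
    rcases List.mem_cons.1 h with h | h
    · obtain ⟨rfl, rfl⟩ := Prod.ext_iff.1 h
      refine ⟨rfl, le_rfl, ?_, _, _, rfl⟩
      simp
    · obtain ⟨h1, h2, h3, h4⟩ := ih h
      refine ⟨h1, by omega, ?_, h4⟩
      simp
      omega

theorem mem_bwdTiles {y x : ℤ} {b : W.Bwd} {l : List W.Cell} {p : ℤ × ℤ} {t : W.tiles.Tile}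
    (h : (p, t) ∈ W.bwdTiles y x b l) :
    p.2 = y ∧ x ≤ p.1 ∧ p.1 < x + l.length ∧ ∃ b' a, t = (Tile.left b' a : W.Tile) := by
  induction l generalizing x with
  | nil => simp [bwdTiles] at h
  | cons a l ih =>
    rcases List.mem_append.1 h with h | h
    · obtain ⟨h1, h2, h3, h4⟩ := ih h
      refine ⟨h1, by omega, ?_, h4⟩
      simp
      omega
    · obtain ⟨rfl, rfl⟩ := Prod.ext_iff.1 (List.mem_singleton.1 h)
      refine ⟨rfl, le_rfl, ?_, _, _, rfl⟩
      simp

/-- Each tile is held cooperatively by the state from the west and the cell from the south, both of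
strength 1; together they determine the tile. -/
theorem fwdTiles_spec {y : ℤ} {l : List W.Cell} : ∀ {x : ℤ} {q : W.Fwd} {α : W.tiles.Assembly},
    Live α (x, y) .west (.right q) → RowAt α (y - 1) x l → (∀ x' ≥ x, α (x', y) = none) →
    Relation.ReflTransGen Forced α (attachAll α (W.fwdTiles y x q l)) ∧
    Live (attachAll α (W.fwdTiles y x q l)) (x + l.length, y) .west
      (.right (W.sweepFwd q l).1) ∧
    RowAt (attachAll α (W.fwdTiles y x q l)) y x (W.sweepFwd q l).2 := by
  induction l with
  | nil =>
    intro x q α h _ _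
    refine ⟨.refl, ?_, trivial⟩
    change Live α _ _ _
    simpa [sweepFwd] using h
  | cons a l ih =>
    intro x q α h hrow hempty
    obtain ⟨hf, hl⟩ := h.step (t := .right q a) (by simp) rfl
      (by
        rintro s σ hσ
        cases s <;> simp [port] at hσ <;> subst hσ
        · simpa [Side.vec, Side.opp, ← sub_eq_add_neg] using hrow.1
        · exact h.sends)
      (s' := .east) rfl trivial (hempty (x + 1) (by omega)) (by simp [Side.vec]) rfl
    have hsub : Sub α (W.tiles.attach α ((x, y), (Tile.right q a : W.Tile))) := sub_attach h.empty
    obtain ⟨h1, h2, h3⟩ := ih (x := x + 1) (q := (W.fwd q a).1) hl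
      (hrow.2.mono hsub) (fun x' hx' => by
        have : x' ≠ x := by omega
        simpa [TileData.attach, Function.update_apply, this] using hempty x' (by omega))
    refine ⟨.head hf h1, ?_, ?_, h3⟩
    · have : x + ((a :: l).length : ℤ) = x + 1 + l.length := by simp; ring
      rw [this]
      exact h2
    · exact (sends_attach rfl).mono (sub_of_forced h1)

theorem bwdTiles_spec {y : ℤ} {l : List W.Cell} : ∀ {x : ℤ} {b : W.Bwd} {α : W.tiles.Assembly},
    Live α (x + l.length - 1, y) .east (.left b) → RowAt α (y - 1) x l →
    (∀ x' < x + l.length, α (x', y) = none) →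
    Relation.ReflTransGen Forced α (attachAll α (W.bwdTiles y x b l)) ∧
    Live (attachAll α (W.bwdTiles y x b l)) (x - 1, y) .east (.left (W.sweepBwd b l).1) ∧
    RowAt (attachAll α (W.bwdTiles y x b l)) y x (W.sweepBwd b l).2 := by
  induction l with
  | nil =>
    intro x b α h _ _
    refine ⟨.refl, ?_, trivial⟩
    change Live α _ _ _
    simpa [sweepBwd] using h
  | cons a l ih =>
    intro x b α h hrow hempty
    have e : x + ((a :: l).length : ℤ) = x + 1 + l.length := by simp; ring
    rw [e] at h hempty
    -- The sweep enters from the right, so the tail of the list is tiled before its head.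
    obtain ⟨h1, h2, h3⟩ := ih h hrow.2 hempty
    have hsub := sub_of_forced h1
    rw [add_sub_cancel_right] at h2
    obtain ⟨hf, hl⟩ := h2.step (t := .left (W.sweepBwd b l).1 a) (by simp) rfl
      (by
        rintro s σ hσ
        cases s <;> simp [port] at hσ <;> subst hσ
        · simpa [Side.vec, Side.opp, ← sub_eq_add_neg] using hrow.1.mono hsub
        · exact h2.sends)
      (s' := .west) rfl trivial (by
        rw [attachAll_apply_of_notMem]
        · exact hempty (x - 1) (by omega)
        · rintro ⟨p, t⟩ hp rfl
          have := (mem_bwdTiles hp).2.1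
          simp at this) (by simp [Side.vec, ← sub_eq_add_neg]) rfl
    have hsub' := sub_attach (T := W.tiles)
      (a := ((x, y), (Tile.left (W.sweepBwd b l).1 a : W.Tile))) h2.empty
    have eq : attachAll α (W.bwdTiles y x b (a :: l)) = _ :=
      attachAll_append (T := W.tiles) α (W.bwdTiles y (x + 1) b l)
        [((x, y), (Tile.left (W.sweepBwd b l).1 a : W.Tile))]
    rw [eq]
    exact ⟨h1.tail hf, hl, sends_attach rfl, h3.mono hsub'⟩

end SweepMachine

/-! ### Blocks, the seed, and the assemblies of words of events -/

namespace SweepMachine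

open TileData

variable {W : SweepMachine}

/-! ### The tiles that model one event -/

variable (W) in
/-- The tiles that model the event `e` in rows `y` and `y + 1`. -/
def block (y : ℤ) (K : W.Ctrl) (row : List W.Cell) (e : W.Event) :
    List ((ℤ × ℤ) × W.tiles.Tile) :=
  ((0, y), (Tile.choice K e : W.Tile)) :: (W.fwdTiles y 1 (W.start K e) row ++
    ((((row.length : ℤ) + 1, y), (Tile.grow (W.sweepFwd (W.start K e) row).1 : W.Tile)) ::
      (((row.length : ℤ) + 2, y), (Tile.corner (W.turned K row e).1 : W.Tile)) ::
      (((row.length : ℤ) + 2, y + 1), (Tile.turn (W.turned K row e).1 : W.Tile)) ::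
      (W.bwdTiles (y + 1) 1 (W.turned K row e).1 (W.midRow K row e) ++
        [((0, y + 1), (Tile.final (W.swept K row e).1 : W.Tile))])))

/-- The configuration is finished below row `y`, where it presents a control state and a row. -/
structure Ready (α : W.tiles.Assembly) (y : ℤ) (K : W.Ctrl) (row : List W.Cell) : Prop where
  live : Live α (0, y) .south (.ctrl K)
  cells : RowAt α (y - 1) 1 row
  wall : Sends α ((row.length : ℤ) + 1, y - 1) .north .wall
  empty : ∀ x y' : ℤ, y ≤ y' → α (x, y') = none

theorem attach_apply_of_ne {α : W.tiles.Assembly} {z p : ℤ × ℤ} {t : W.Tile} (h : p ≠ z) :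
    W.tiles.attach α (z, t) p = α p := by
  simp [TileData.attach, h]

namespace Ready

variable {α : W.tiles.Assembly} {y : ℤ} {K : W.Ctrl} {row : List W.Cell}

/-- A control signal has strength 2, so a choice tile needs nothing else. Uniform random assembly
therefore draws the next event uniformly from the enabled ones. -/
theorem attachments_eq (h : Ready α y K row) : W.tiles.attachments α =
    (fun e => (((0, y) : ℤ × ℤ), (Tile.choice K e : W.Tile))) '' W.enabled K := by
  ext ⟨p, t⟩
  rw [h.live.mem_attachments_iff, Set.mem_image]
  constructor
  · rintro ⟨rfl, ht, -⟩
    cases t <;> simp [port] at ht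
    obtain ⟨he, rfl⟩ := ht
    exact ⟨_, he, rfl⟩
  · rintro ⟨e, he, h'⟩
    obtain ⟨rfl, rfl⟩ := Prod.ext_iff.1 h'
    refine ⟨rfl, by simp [port, he], ?_⟩
    rintro s σ hσ
    cases s <;> simp [port] at hσ
    obtain ⟨-, rfl⟩ := hσ
    exact h.live.sends

/-- After the choice no control signal is met until the block is complete, so every addition is
forced. The sweeps recognise the ends of the row by what stands below: the wall makes the row grow
and turn, the base ends the way back. -/
theorem block_spec (h : Ready α y K row) {e : W.Event} (he : e ∈ W.enabled K) :
    Relation.ReflTransGen Forced (W.tiles.attach α ((0, y), (Tile.choice K e : W.Tile)))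
      (attachAll α (W.block y K row e)) ∧
    Ready (attachAll α (W.block y K row e)) (y + 2) (W.finish (W.swept K row e).1)
      (W.swept K row e).2 := by
  have hmem : (((0, y) : ℤ × ℤ), (Tile.choice K e : W.Tile)) ∈ W.tiles.attachments α := by
    rw [h.attachments_eq]
    exact ⟨e, he, rfl⟩
  have hl₀ := h.live.attach (h.live.mem_attachments_iff.1 hmem).2.2 (s' := .east) (z' := (1, y))
    rfl trivial (h.empty _ _ le_rfl) (by simp [Side.vec]) rfl
  have hsub₀ := sub_attach (T := W.tiles) (a := (((0, y) : ℤ × ℤ), (Tile.choice K e : W.Tile)))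
    h.live.empty
  have hemp₀ : ∀ x y' : ℤ, y ≤ y' → (x ≠ 0 ∨ y' ≠ y) →
      W.tiles.attach α ((0, y), (Tile.choice K e : W.Tile)) (x, y') = none := fun x y' hy hx => by
    rw [attach_apply_of_ne (by simp; omega), h.empty x y' hy]
  have hbase₀ := sends_attach (α := α) (z := (0, y)) (t := .choice K e) (s := .north) rfl
  set α₀ : W.tiles.Assembly := W.tiles.attach α ((0, y), (Tile.choice K e : W.Tile)) with hα₀
  have hblock : attachAll α (W.block y K row e) = attachAll α₀ (W.fwdTiles y 1 (W.start K e) row ++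
    ((((row.length : ℤ) + 1, y), (Tile.grow (W.sweepFwd (W.start K e) row).1 : W.Tile)) ::
      (((row.length : ℤ) + 2, y), (Tile.corner (W.turned K row e).1 : W.Tile)) ::
      (((row.length : ℤ) + 2, y + 1), (Tile.turn (W.turned K row e).1 : W.Tile)) ::
      (W.bwdTiles (y + 1) 1 (W.turned K row e).1 (W.midRow K row e) ++
        [((0, y + 1), (Tile.final (W.swept K row e).1 : W.Tile))]))) := rfl
  rw [hblock, attachAll_append]
  clear hblock
  -- the forward sweep
  obtain ⟨hf₁, hl₁, hrow₁⟩ := fwdTiles_spec hl₀ (h.cells.mono hsub₀)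
    (fun x' hx' => hemp₀ _ _ le_rfl (by omega))
  have hsub₁ := sub_of_forced hf₁
  have hemp₁ : ∀ x y' : ℤ, y ≤ y' → (row.length + 1 ≤ x ∨ y' ≠ y) →
      attachAll α₀ (W.fwdTiles y 1 (W.start K e) row) (x, y') = none := fun x y' hy hx => by
    rw [attachAll_apply_of_notMem, hemp₀ x y' hy (by omega)]
    rintro ⟨p, t⟩ hp rfl
    obtain ⟨h1, h2, h3, -⟩ := mem_fwdTiles hp
    simp only at h1 h2 h3
    omega
  set α₁ : W.tiles.Assembly := attachAll α₀ (W.fwdTiles y 1 (W.start K e) row) with hα₁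
  have hwall₁ := (h.wall.mono hsub₀).mono hsub₁
  have hbase₁ := hbase₀.mono hsub₁
  rw [add_comm] at hl₁
  rw [attachAll_cons, attachAll_cons, attachAll_cons, attachAll_append, attachAll_cons,
    attachAll_nil]
  clear_value α₁
  clear hα₁ hsub₁ hemp₀ hl₀ hbase₀ hα₀
  -- the appended cell
  obtain ⟨hf₂, hl₂⟩ := hl₁.step (t := .grow (W.sweepFwd (W.start K e) row).1) (by simp) rfl
    (by
      rintro s σ hσ
      cases s <;> simp [port] at hσ <;> subst hσ
      · simpa [Side.vec, Side.opp, ← sub_eq_add_neg] using hwall₁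
      · exact hl₁.sends)
    (s' := .east) (z' := ((row.length : ℤ) + 2, y)) rfl trivial (hemp₁ _ _ le_rfl (by omega))
    (by simp [Side.vec]; ring) rfl
  have hsub₂ := sub_of_forced (.single hf₂)
  have hcell₂ := sends_attach (α := α₁) (z := ((row.length : ℤ) + 1, y))
    (t := .grow (W.sweepFwd (W.start K e) row).1) (s := .north) rfl
  have hemp₂ : ∀ x y' : ℤ, y ≤ y' → (row.length + 2 ≤ x ∨ y' ≠ y) →
      W.tiles.attach α₁ (((row.length : ℤ) + 1, y),
        (Tile.grow (W.sweepFwd (W.start K e) row).1 : W.Tile)) (x, y') = none :=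
    fun x y' hy hx => by
      rw [attach_apply_of_ne (by simp; omega), hemp₁ x y' hy (by omega)]
  have hbase₂ := hbase₁.mono hsub₂
  have hrow₂ : RowAt _ y 1 (W.midRow K row e) :=
    rowAt_append.2 ⟨hrow₁.mono hsub₂, by simpa [add_comm, turned] using hcell₂, trivial⟩
  set α₂ : W.tiles.Assembly := W.tiles.attach α₁ (((row.length : ℤ) + 1, y),
        (Tile.grow (W.sweepFwd (W.start K e) row).1 : W.Tile)) with hα₂
  clear_value α₂
  clear hα₂ hemp₁ hl₁ hrow₁ hwall₁ hbase₁ hsub₂ hcell₂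
  -- the two corners
  obtain ⟨hf₃, hl₃⟩ := hl₂.step (t := .corner (W.turned K row e).1) (by simp) rfl
    (by
      rintro s σ hσ
      cases s <;> simp [port] at hσ
      subst hσ
      exact hl₂.sends)
    (s' := .north) (z' := ((row.length : ℤ) + 2, y + 1)) rfl trivial (hemp₂ _ _ (by omega) (by omega))
    (by simp [Side.vec]) rfl
  have hsub₃ := sub_of_forced (.single hf₃)
  have hemp₃ : ∀ x y' : ℤ, y + 1 ≤ y' → W.tiles.attach α₂ (((row.length : ℤ) + 2, y),
        (Tile.corner (W.turned K row e).1 : W.Tile)) (x, y') = none := fun x y' hy => by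
    rw [attach_apply_of_ne (by simp; omega), hemp₂ x y' (by omega) (by omega)]
  obtain ⟨hf₄, hl₄⟩ := hl₃.step (t := .turn (W.turned K row e).1) (by simp) rfl
    (by
      rintro s σ hσ
      cases s <;> simp [port] at hσ
      subst hσ
      exact hl₃.sends)
    (s' := .west) (z' := ((row.length : ℤ) + 1, y + 1)) rfl trivial (hemp₃ _ _ le_rfl)
    (by simp [Side.vec]; ring) rfl
  have hsub₄ := hsub₃.trans (sub_of_forced (.single hf₄))
  have hwall₄ := sends_attach (α := W.tiles.attach α₂ (((row.length : ℤ) + 2, y),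
        (Tile.corner (W.turned K row e).1 : W.Tile))) (z := ((row.length : ℤ) + 2, y + 1))
    (t := .turn (W.turned K row e).1) (s := .north) rfl
  have hemp₄ : ∀ x y' : ℤ, y + 1 ≤ y' → (x < row.length + 2 ∨ y' ≠ y + 1) →
      W.tiles.attach (W.tiles.attach α₂ (((row.length : ℤ) + 2, y),
        (Tile.corner (W.turned K row e).1 : W.Tile))) (((row.length : ℤ) + 2, y + 1),
        (Tile.turn (W.turned K row e).1 : W.Tile)) (x, y') = none := fun x y' hy hx => by
    rw [attach_apply_of_ne (by simp; omega), hemp₃ x y' (by omega)]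
  have hbase₄ := hbase₂.mono hsub₄
  have hrow₄ := hrow₂.mono hsub₄
  set α₄ : W.tiles.Assembly := W.tiles.attach (W.tiles.attach α₂ (((row.length : ℤ) + 2, y),
        (Tile.corner (W.turned K row e).1 : W.Tile))) (((row.length : ℤ) + 2, y + 1),
        (Tile.turn (W.turned K row e).1 : W.Tile)) with hα₄
  have hf' : Relation.ReflTransGen Forced α₀ α₄ := ((hf₁.tail hf₂).tail hf₃).tail hf₄
  clear_value α₄
  clear hα₄ hf₁ hf₂ hf₃ hf₄ hsub₃ hsub₄ hemp₂ hemp₃ hl₂ hl₃ hrow₂ hbase₂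
  -- the backward sweep
  have hlen : (W.midRow K row e).length = row.length + 1 := by simp [midRow]
  obtain ⟨hf₅, hl₅, hrow₅⟩ := bwdTiles_spec (y := y + 1) (l := W.midRow K row e) (x := 1)
    (b := (W.turned K row e).1) (α := α₄)
    (by
      have : (1 : ℤ) + (W.midRow K row e).length - 1 = row.length + 1 := by rw [hlen]; push_cast; ring
      rw [this]
      exact hl₄)
    (by simpa using hrow₄) (fun x' hx' => hemp₄ _ _ le_rfl (by rw [hlen] at hx'; push_cast at hx'; omega))
  have hsub₅ := sub_of_forced hf₅
  have hemp₅ : ∀ x y' : ℤ, y + 1 ≤ y' → (x < 1 ∨ y' ≠ y + 1) →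
      attachAll α₄ (W.bwdTiles (y + 1) 1 (W.turned K row e).1 (W.midRow K row e)) (x, y') = none :=
    fun x y' hy hx => by
      rw [attachAll_apply_of_notMem, hemp₄ x y' hy (by omega)]
      rintro ⟨p, t⟩ hp rfl
      obtain ⟨h1, h2, h3, -⟩ := mem_bwdTiles hp
      simp only at h1 h2 h3
      omega
  have hwall₅ := hwall₄.mono hsub₅
  have hbase₅ := hbase₄.mono hsub₅
  set α₅ : W.tiles.Assembly := attachAll α₄
    (W.bwdTiles (y + 1) 1 (W.turned K row e).1 (W.midRow K row e)) with hα₅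
  clear_value α₅
  obtain ⟨hf₆, hl₆⟩ := hl₅.step (t := .final (W.swept K row e).1) (by simp) rfl
    -- The base was sent by the choice tile of this same block, one row below.
    (by
      rintro s σ hσ
      cases s <;> simp [port] at hσ <;> subst hσ
      · simpa [Side.vec, Side.opp] using hbase₅
      · exact hl₅.sends)
    (s' := .north) (z' := (0, y + 2)) rfl trivial (hemp₅ _ _ (by omega) (by omega))
    (by simp [Side.vec]; ring) rfl
  have hsub₆ := sub_of_forced (.single hf₆)
  refine ⟨(hf'.trans hf₅).tail hf₆, hl₆, ?_, ?_, ?_⟩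
  · have : y + 2 - 1 = y + 1 := by ring
    rw [this]
    exact hrow₅.mono hsub₆
  · have h1 : y + 2 - 1 = y + 1 := by ring
    -- The row has gained a cell, so the wall has moved one column to the right; the `turn` tile
    -- sends it there.
    have h2 : (((W.swept K row e).2.length : ℤ) + 1) = row.length + 2 := by
      simp [swept, hlen]
      ring
    rw [h1, h2]
    exact hwall₅.mono hsub₆
  · intro x y' hy
    exact (attach_apply_of_ne (by simp; omega)).trans (hemp₅ x y' (by omega) (by omega))

end Ready

end SweepMachine

namespace SweepMachine

open TileData

variable {W : SweepMachine}

/-! ### The seed -/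

theorem seedFrom_eq_some {k : ℕ} {p : ℤ × ℤ} {t : W.Tile} : W.seedFrom k p = some t ↔
    ∃ j : Fin (W.initRow.length + 2), k ≤ (j : ℕ) ∧ p = (((j : ℕ) : ℤ), -1) ∧ t = .seed j := by
  obtain ⟨x, y⟩ := p
  unfold seedFrom
  constructor
  · intro h
    split_ifs at h with hp
    simp only at hp
    refine ⟨_, ?_, ?_, (Option.some_injective _ h).symm⟩
    · simp only
      omega
    · ext <;> simp only <;> omega
  · rintro ⟨j, hj, h, rfl⟩
    obtain ⟨rfl, rfl⟩ := Prod.ext_iff.1 h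
    rw [dif_pos ⟨rfl, by simp only; omega, by simp only; omega⟩]
    simp

theorem seedFrom_apply {k : ℕ} (j : Fin (W.initRow.length + 2)) (hj : k ≤ (j : ℕ)) :
    W.seedFrom k (((j : ℕ) : ℤ), -1) = some (.seed j) :=
  seedFrom_eq_some.2 ⟨j, hj, rfl, rfl⟩

theorem seedFrom_eq_none {k : ℕ} {x y : ℤ} (h : y ≠ -1 ∨ x < k) :
    W.seedFrom k (x, y) = none := by
  unfold seedFrom
  rw [dif_neg]
  simp only
  omega

theorem seedTop_row (l : List W.Cell) (j : ℕ) (h : W.initRow.drop j = l) :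
    RowAt (W.seedFrom 0) (-1) ((j : ℤ) + 1) l := by
  induction l generalizing j with
  | nil => trivial
  | cons a l ih =>
    have hj : j < W.initRow.length := by
      by_contra hc
      rw [List.drop_eq_nil_of_le (by omega)] at h
      simp at h
    have ha : W.initRow[j]? = some a := by
      have := congrArg List.head? h
      simpa using this
    refine ⟨⟨.seed ⟨j + 1, by omega⟩, ?_, ?_⟩, ?_⟩
    · exact_mod_cast seedFrom_apply (W := W) (k := 0) ⟨j + 1, by omega⟩ (Nat.zero_le _)
    · simp [port, seedTop, ha]
    · have := ih (j + 1) (by rw [← List.drop_drop, h]; rfl)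
      exact_mod_cast this

/-- The links, though active, all point at occupied positions. Above the row only column 0 sends an
active signal. -/
theorem seed_live : Live (W.seedFrom 0) (0, 0) .south (.ctrl W.initCtrl) := by
  refine ⟨?_, ?_, seedFrom_eq_none (by simp), ?_, trivial⟩
  · intro p t s σ hp ht
    obtain ⟨j, -, rfl, rfl⟩ := seedFrom_eq_some.1 hp
    cases s <;> simp [port] at ht
    have := seedFrom_apply (W := W) (k := 0) ⟨j + 1, by omega⟩ (Nat.zero_le _)
    simp only [Side.vec, Prod.mk_add_mk, add_zero]
    push_cast at this
    rw [this]
    simp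
  · intro p t s σ hp ht hσ he
    obtain ⟨⟨j, hjn⟩, -, rfl, rfl⟩ := seedFrom_eq_some.1 hp
    cases j with
    | zero =>
      cases s <;> simp [port] at ht
      subst ht
      simp [Side.vec, Side.opp, seedTop]
    | succ j =>
      cases s <;> simp [port] at ht <;> subst ht
      · exact absurd hσ (seedTop_succ_not_active j)
      · have := seedFrom_apply (W := W) (k := 0) ⟨j, by omega⟩ (Nat.zero_le _)
        simp [Side.vec, this] at he
  · exact ⟨.seed 0, by simpa [Side.vec] using seedFrom_apply (W := W) (k := 0) 0 (Nat.zero_le _),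
      by simp [port, Side.opp, seedTop]⟩

theorem seed_ready : Ready (W.seedFrom 0) 0 W.initCtrl W.initRow := by
  refine ⟨seed_live, ?_, ?_, ?_⟩
  · simpa using seedTop_row (W := W) W.initRow 0 rfl
  · refine ⟨.seed (Fin.last _), ?_, ?_⟩
    · simpa using seedFrom_apply (W := W) (k := 0) (Fin.last _) (Nat.zero_le _)
    · simp [port, seedTop]
  · intro x y hy
    exact seedFrom_eq_none (by omega)

/-- The seed row is itself grown westward from its last tile, along links of strength 2, and a
single tile has no cut. -/
theorem seedFrom_stable (k : ℕ) (hk : k ≤ W.initRow.length + 1) :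
    W.tiles.Stable (W.seedFrom k) := by
  induction hk using Nat.decreasingInduction with
  | self =>
    intro A hA ⟨x, hx⟩ ⟨y, hy, hyA⟩
    have key : ∀ z, z ∈ W.tiles.support (W.seedFrom (W.initRow.length + 1)) →
        z = (((W.initRow.length : ℤ) + 1, -1) : ℤ × ℤ) := by
      intro z hz
      obtain ⟨t, ht⟩ := Option.ne_none_iff_exists'.1 hz
      obtain ⟨j, hj, rfl, -⟩ := seedFrom_eq_some.1 ht
      have : (j : ℕ) = W.initRow.length + 1 := by omega
      simp [this]
    rw [key y hy, ← key x (hA hx)] at hyA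
    exact absurd hx hyA
  | of_succ k hk ih =>
    have hk' : k < W.initRow.length + 2 := by omega
    have hatt : (((k : ℤ), -1), (Tile.seed ⟨k, hk'⟩ : W.Tile)) ∈
        W.tiles.attachments (W.seedFrom (k + 1)) := by
      refine ⟨seedFrom_eq_none (by push_cast; omega), ?_⟩
      have hu := seedFrom_apply (W := W) (k := k + 1) ⟨k + 1, by omega⟩ le_rfl
      push_cast at hu
      have hb : W.tiles.bondTo (W.seedFrom (k + 1)) ((k : ℤ), -1) (Tile.seed ⟨k, hk'⟩) .east = 2 := by
        have e : (((k : ℤ), -1) : ℤ × ℤ) + Side.east.vec = ((k : ℤ) + 1, -1) := by simp [Side.vec]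
        simp only [bondTo, e, hu]
        refine (bond_of_port (b := false) (σ := .link k) ?_ ?_).trans rfl
        · simp [port]
          omega
        · simp [port, Side.opp]
      unfold strength
      simp only
      rw [hb]
      omega
    have heq : W.tiles.attach (W.seedFrom (k + 1)) (((k : ℤ), -1), (Tile.seed ⟨k, hk'⟩ : W.Tile)) =
        W.seedFrom k := by
      funext p
      by_cases hp : p = ((k : ℤ), -1)
      · subst hp
        rw [seedFrom_apply (W := W) (k := k) ⟨k, hk'⟩ le_rfl]
        simp [TileData.attach]
      · rw [attach_apply_of_ne hp]
        have : ∀ t, W.seedFrom (k + 1) p = some t ↔ W.seedFrom k p = some t := by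
          intro t
          rw [seedFrom_eq_some, seedFrom_eq_some]
          constructor
          · rintro ⟨j, hj, h⟩
            exact ⟨j, by omega, h⟩
          · rintro ⟨j, hj, rfl, rfl⟩
            refine ⟨j, ?_, rfl, rfl⟩
            have : (j : ℕ) ≠ k := by
              rintro rfl
              exact hp rfl
            omega
        exact Option.ext this
    rw [← heq]
    exact ih.attach hatt

variable (W) in
/-- The tile assembly system of the machine, with its seed. -/
noncomputable abbrev system : TileSystem where
  toTileData := W.tiles
  seed_finite := by
    refine (Set.finite_range fun j : Fin (W.initRow.length + 2) =>
      ((((j : ℕ) : ℤ), -1) : ℤ × ℤ)).subset fun p hp => ?_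
    obtain ⟨t, ht⟩ := Option.ne_none_iff_exists'.1 hp
    obtain ⟨j, -, rfl, -⟩ := seedFrom_eq_some.1 ht
    exact ⟨j, rfl⟩
  seed_nonempty := ⟨(((0 : ℕ) : ℤ), -1), by
    have := seedFrom_apply (W := W) (k := 0) 0 (Nat.zero_le _)
    rw [support, Set.mem_ofPred_eq]
    intro h
    simp at this h
    simp [this] at h⟩
  seed_stable := seedFrom_stable 0 (Nat.zero_le _)

/-! ### The configurations that represent words of events -/

variable (W) in
/-- The configuration that represents a word of events (latest first). -/
noncomputable def asm : List W.Event → W.tiles.Assembly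
  | [] => W.seedFrom 0
  | e :: l => attachAll (asm l) (W.block (2 * l.length) (W.run l).1 (W.run l).2 e)

theorem ready_asm {l : List W.Event} (h : W.Valid l) :
    Ready (W.asm l) (2 * l.length) (W.run l).1 (W.run l).2 := by
  induction l with
  | nil => exact seed_ready
  | cons e l ih =>
    have := ((ih h.2).block_spec h.1).2
    have e2 : 2 * (((e :: l).length : ℕ) : ℤ) = 2 * l.length + 2 := by simp; ring
    rw [e2]
    exact this

theorem forced_asm {e : W.Event} {l : List W.Event} (h : W.Valid (e :: l)) :
    Relation.ReflTransGen Forced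
      (W.tiles.attach (W.asm l) ((0, 2 * l.length), (Tile.choice (W.run l).1 e : W.Tile)))
      (W.asm (e :: l)) :=
  ((ready_asm h.2).block_spec h.1).1

theorem produces_asm_cons {e : W.Event} {l : List W.Event} (h : W.Valid (e :: l)) :
    W.tiles.Produces (W.asm l) (W.asm (e :: l)) := by
  refine .head ⟨((0, 2 * l.length), (Tile.choice (W.run l).1 e : W.Tile)), ?_, rfl⟩
    (produces_of_forced (forced_asm h))
  rw [(ready_asm h.2).attachments_eq]
  exact ⟨e, h.1, rfl⟩

theorem stable_asm {l : List W.Event} (h : W.Valid l) : W.tiles.Stable (W.asm l) := by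
  induction l with
  | nil => exact seedFrom_stable 0 (Nat.zero_le _)
  | cons e l ih => exact (ih h.2).produces (produces_asm_cons h)

theorem asm_cons_choice {e : W.Event} {l : List W.Event} (h : W.Valid (e :: l)) :
    W.asm (e :: l) (0, 2 * l.length) = some (Tile.choice (W.run l).1 e : W.Tile) :=
  sub_of_forced (forced_asm h) _ _ (by simp [TileData.attach])

theorem asm_append_sub {u l : List W.Event} (h : W.Valid (u ++ l)) :
    Sub (W.asm l) (W.asm (u ++ l)) ∧ W.Valid l := by
  induction u with
  | nil => exact ⟨Sub.refl _, h⟩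
  | cons e u ih => exact ⟨(ih h.2).1.trans (produces_asm_cons h).sub, (ih h.2).2⟩

/-- The tile in column 0 at height `2 * l.length` names the event that follows `l`. The smaller
configuration hands its choices to the larger one, so the words agree event by event, oldest first.
-/
theorem suffix_of_sub {l l' : List W.Event} (h : W.Valid l) (h' : W.Valid l')
    (hs : Sub (W.asm l) (W.asm l')) : l <:+ l' := by
  induction l with
  | nil => exact List.nil_suffix
  | cons e l ih =>
    obtain ⟨u, rfl⟩ := ih h.2 ((produces_asm_cons h).sub.trans hs)
    have hc := hs _ _ (asm_cons_choice h)
    rcases List.eq_nil_or_concat u with rfl | ⟨v, e', rfl⟩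
    -- If nothing follows `l`, the place of the next choice is still empty.
    · rw [List.nil_append, (ready_asm h.2).live.empty] at hc
      simp at hc
    · have hv : v.concat e' ++ l = v ++ e' :: l := by simp
      rw [hv] at h' hc ⊢
      obtain ⟨hsub, hval⟩ := asm_append_sub h'
      have := Option.some_injective _ (hc.symm.trans (hsub _ _ (asm_cons_choice hval)))
      obtain ⟨-, rfl⟩ : W.run l = W.run l ∧ e = e' := by simpa using this
      exact List.suffix_append _ _

/-- Validity is not needed: this tile is the last addition of its block, whatever was there before.
-/
theorem asm_cons_final {e : W.Event} {l : List W.Event} :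
    W.asm (e :: l) (0, 2 * l.length + 1) =
      some (Tile.final (W.swept (W.run l).1 (W.run l).2 e).1 : W.Tile) := by
  have key : ∀ (L : List ((ℤ × ℤ) × W.tiles.Tile)) (z : ℤ × ℤ) (t : W.tiles.Tile),
      [(z, t)] <:+ L → attachAll (W.asm l) L z = some t := by
    rintro _ z t ⟨L, rfl⟩
    rw [attachAll_append]
    exact Function.update_self ..
  exact key _ _ _ ((((((List.suffix_append _ _).trans (List.suffix_cons _ _)).trans
    (List.suffix_cons _ _)).trans (List.suffix_cons _ _)).trans (List.suffix_append _ _)).trans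
    (List.suffix_cons _ _))

theorem eq_of_final {e : W.Event} {l : List W.Event} {p : ℤ × ℤ} {b : W.Bwd}
    (h : W.asm l p = none) (h' : W.asm (e :: l) p = some (Tile.final b : W.Tile)) :
    p = (0, 2 * (l.length : ℤ) + 1) := by
  have := (mem_of_attachAll_apply (T := W.tiles) h').resolve_left (by simp [h])
  unfold block at this
  rcases List.mem_cons.1 this with h | h
  · simp at h
  rcases List.mem_append.1 h with h | h
  · obtain ⟨-, -, -, q, a, h⟩ := mem_fwdTiles h
    simp at h
  rcases List.mem_cons.1 h with h | h
  · simp at h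
  rcases List.mem_cons.1 h with h | h
  · simp at h
  rcases List.mem_cons.1 h with h | h
  · simp at h
  rcases List.mem_append.1 h with h | h
  · obtain ⟨-, -, -, q, a, h⟩ := mem_bwdTiles h
    simp at h
  · exact (Prod.ext_iff.1 (List.mem_singleton.1 h)).1

end SweepMachine

/-! ### Fair runs on which a subaveraging function stays positive -/

namespace DistSystem

variable {S : DistSystem}

theorem History.ext {H H' : S.History} (h : H.trace = H'.trace) : H = H' := by
  cases H; cases H'; cases h; rfl

theorem Legal.of_suffix {l l' : List (S.Event × S.Config)} (h : l <:+ l') (h' : S.Legal l') :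
    S.Legal l := by
  induction l' with
  | nil => rwa [List.suffix_nil.1 h]
  | cons a l' ih =>
    rcases List.suffix_cons_iff.1 h with rfl | h
    · exact h'
    · exact ih h h'.2

/-- The history after one more event. -/
def History.snoc (H : S.History) {φ : S.Event} {C : S.Config} (h : S.Step H.current φ C) :
    S.History := ⟨(φ, C) :: H.trace, h, H.legal⟩

theorem History.step_snoc (H : S.History) {φ : S.Event} {C : S.Config}
    (h : S.Step H.current φ C) : S.unfold.Step H φ (H.snoc h) := rfl

theorem step_of_unfold {H H' : S.History} {φ : S.Event} (h : S.unfold.Step H φ H') :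
    S.Step H.current φ H'.current := by
  have := H'.legal
  rw [show H'.trace = _ from h] at this
  exact this.1

/-- The event is possible after the history. -/
def Enabled (H : S.History) (φ : S.Event) : Prop := ∃ C, S.Step H.current φ C

section FairRun

variable {f : S.History → ℝ}

/-- One event that leads to a history where `f` is positive. -/
def PosStep (f : S.History → ℝ) (H H' : S.History) : Prop :=
  ∃ φ, S.unfold.Step H φ H' ∧ 0 < f H'

theorem pos_of_posStep {H H' : S.History} (h : Relation.ReflTransGen (PosStep f) H H')
    (hH : 0 < f H) : 0 < f H' := by
  cases h with
  | refl => exact hH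
  | tail _ h => exact h.choose_spec.2

theorem suffix_of_posStep {H H' : S.History} (h : Relation.ReflTransGen (PosStep f) H H') :
    H.trace <:+ H'.trace := by
  induction h with
  | refl => exact List.suffix_refl _
  | tail _ h ih =>
    obtain ⟨φ, h, -⟩ := h
    rw [show _ = _ from h]
    exact ih.trans (List.suffix_cons _ _)

/-- Every event lengthens the trace by one entry, so each trace in between belongs to a history on
the path. -/
theorem posStep_of_suffix {H H' G : S.History} (h : Relation.ReflTransGen (PosStep f) H H')
    (hG : H.trace <:+ G.trace) (hG' : G.trace <:+ H'.trace) :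
    Relation.ReflTransGen (PosStep f) H G := by
  induction h with
  | refl =>
    rw [History.ext (hG.eq_of_length_le hG'.length_le)]
  | @tail D D' hD h ih =>
    obtain ⟨φ, hs, hf⟩ := h
    rw [show _ = _ from hs] at hG'
    rcases List.suffix_cons_iff.1 hG' with h | h
    · rw [History.ext (h.trans (show D'.trace = _ from hs).symm)]
      exact hD.tail ⟨φ, hs, hf⟩
    · exact ih h

/-- `f` does not exceed its average over the possible next histories. -/
def SubAverage (f : S.History → ℝ) : Prop :=
  ∀ H, ∃ (A : Finset S.Event) (next : S.Event → S.History),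
    (∀ e, e ∈ A ↔ Enabled H e) ∧ (∀ e ∈ A, S.unfold.Step H e (next e)) ∧
    (0 < f H → f H * A.card ≤ ∑ e ∈ A, f (next e))

/-- An event that is possible remains possible until it occurs. -/
def Persistent (S : DistSystem) : Prop :=
  ∀ (H H' : S.History) (φ e : S.Event), Enabled H φ → S.unfold.Step H e H' → e ≠ φ → Enabled H' φ

/-- Otherwise `φ`, which stays possible while it is avoided, contributes nothing positive to any
average. Its share is at least `1 / B`, so looking one event further ahead improves the upper bound
on `f` by the factor `1 - 1 / B`, and `f H ≤ 0` in the limit. -/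
theorem exists_posStep_event [Finite S.Event] (hf1 : ∀ H, f H ≤ 1) (havg : SubAverage f)
    (hpers : Persistent S) {H : S.History} (hH : 0 < f H) {φ : S.Event} (hφ : Enabled H φ) :
    ∃ G G', Relation.ReflTransGen (PosStep f) H G ∧ S.unfold.Step G φ G' ∧ 0 < f G' := by
  classical
  have := Fintype.ofFinite S.Event
  by_contra hc
  push Not at hc
  set B : ℝ := ((Fintype.card S.Event : ℕ) : ℝ) with hB
  have hB1 : 1 ≤ B := by
    have : Nonempty S.Event := ⟨φ⟩
    rw [hB]; exact_mod_cast Fintype.card_pos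
  set r : ℝ := 1 - 1 / B with hr
  have hr0 : 0 ≤ r := by
    rw [hr, sub_nonneg]
    exact div_le_one_of_le₀ hB1 (by linarith)
  -- The bound must be uniform over all histories on positive paths where `φ` is possible, for the
  -- induction moves on to the successors.
  have key : ∀ k : ℕ, ∀ G, Relation.ReflTransGen (PosStep f) H G → Enabled G φ → f G ≤ r ^ k := by
    intro k
    induction k with
    | zero => intro G _ _; simpa using hf1 G
    | succ k ih =>
      intro G hG hGφ
      have hGpos := pos_of_posStep hG hH
      obtain ⟨A, next, hA, hnext, hsum⟩ := havg G
      have hφA := (hA φ).2 hGφ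
      have hle : ∑ e ∈ A, f (next e) ≤ (A.card - 1) * r ^ k := by
        rw [← Finset.add_sum_erase _ _ hφA]
        have h1 : f (next φ) ≤ 0 := hc _ _ hG (hnext φ hφA)
        have h2 : ∑ e ∈ A.erase φ, f (next e) ≤ ∑ e ∈ A.erase φ, r ^ k := by
          refine Finset.sum_le_sum fun e he => ?_
          obtain ⟨hne, heA⟩ := Finset.mem_erase.1 he
          by_cases hp : 0 < f (next e)
          · exact ih _ (hG.tail ⟨e, hnext e heA, hp⟩) (hpers _ _ _ _ hGφ (hnext e heA) hne)
          · exact (not_lt.1 hp).trans (pow_nonneg hr0 _)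
        rw [Finset.sum_const, Finset.card_erase_of_mem hφA, nsmul_eq_mul,
          Nat.cast_sub (Finset.card_pos.2 ⟨φ, hφA⟩)] at h2
        push_cast at h2
        linarith
      have hn : (0 : ℝ) < A.card := by exact_mod_cast Finset.card_pos.2 ⟨φ, hφA⟩
      have hnB : (A.card : ℝ) ≤ B := by rw [hB]; exact_mod_cast Finset.card_le_univ A
      have h3 : f G ≤ (A.card - 1) * r ^ k / A.card := by
        rw [le_div_iff₀ hn]
        exact (hsum hGpos).trans hle
      refine h3.trans ?_
      rw [pow_succ', mul_div_right_comm]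
      refine mul_le_mul_of_nonneg_right ?_ (pow_nonneg hr0 _)
      rw [sub_div, div_self hn.ne', hr]
      have := one_div_le_one_div_of_le hn hnB
      linarith
  have hr1 : r < 1 := by
    have : 0 < 1 / B := by positivity
    linarith
  have hlim := ge_of_tendsto' (tendsto_pow_atTop_nhds_zero_of_lt_one hr0 hr1)
    fun k => key k H .refl hφ
  linarith

/-- The first component of the unpairing takes every value infinitely often. -/
theorem exists_task (E : Type) [Finite E] [Nonempty E] :
    ∃ task : ℕ → E, ∀ φ n, ∃ k ≥ n, task k = φ := by
  obtain ⟨g, hg⟩ := exists_surjective_nat E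
  refine ⟨fun k => g k.unpair.1, fun φ n => ?_⟩
  obtain ⟨a, ha⟩ := hg φ
  exact ⟨Nat.pair a n, Nat.right_le_pair a n, by simp [ha]⟩

/-- Where a subaveraging function is positive, there begins a fair run along which it stays
positive. -/
theorem exists_fair_run [Finite S.Event] (hf1 : ∀ H, f H ≤ 1) (havg : SubAverage f)
    (hpers : Persistent S) (hlive : ∀ H : S.History, ∃ φ, Enabled H φ) {H₀ : S.History}
    (hH₀ : 0 < f H₀) :
    ∃ (run : ℕ → S.History) (ev : ℕ → S.Event), run 0 = H₀ ∧
      (∀ n, S.unfold.Step (run n) (ev n) (run (n + 1))) ∧ (∀ n, 0 < f (run n)) ∧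
      ∀ φ n, Enabled (run n) φ → ∃ k ≥ n, ev k = φ := by
  classical
  have hne : Nonempty S.Event := ⟨(hlive H₀).choose⟩
  obtain ⟨task, htask⟩ := exists_task S.Event
  -- One round carries out `φ` if it is possible and otherwise some possible event, so that the
  -- trace grows in any case.
  have round : ∀ (H : S.History) (φ : S.Event), ∃ H', 0 < f H →
      Relation.ReflTransGen (PosStep f) H H' ∧ H.trace.length < H'.trace.length ∧
      (Enabled H φ → ∃ G, H.trace <:+ G.trace ∧ S.unfold.Step G φ H') := by
    intro H φ
    by_cases hH : 0 < f H
    swap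
    · exact ⟨H, fun h => absurd h hH⟩
    have aux : ∀ ψ, Enabled H ψ → ∃ H', Relation.ReflTransGen (PosStep f) H H' ∧
        H.trace.length < H'.trace.length ∧ ∃ G, H.trace <:+ G.trace ∧ S.unfold.Step G ψ H' := by
      intro ψ hψ
      obtain ⟨G, G', hG, hs, hp⟩ := exists_posStep_event hf1 havg hpers hH hψ
      have hsuf := suffix_of_posStep hG
      refine ⟨G', hG.tail ⟨ψ, hs, hp⟩, ?_, G, hsuf, hs⟩
      rw [show G'.trace = _ from hs]
      exact Nat.lt_succ_of_le hsuf.length_le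
    by_cases hφ : Enabled H φ
    · obtain ⟨H', h1, h2, h3⟩ := aux φ hφ
      exact ⟨H', fun _ => ⟨h1, h2, fun _ => h3⟩⟩
    · obtain ⟨ψ, hψ⟩ := hlive H
      obtain ⟨H', h1, h2, -⟩ := aux ψ hψ
      exact ⟨H', fun _ => ⟨h1, h2, fun h => absurd h hφ⟩⟩
  choose next hnext using round
  obtain ⟨Y, hY0, hYs⟩ : ∃ Y : ℕ → S.History, Y 0 = H₀ ∧ ∀ k, Y (k + 1) = next (Y k) (task k) :=
    ⟨fun k => Nat.rec H₀ (fun k H => next H (task k)) k, rfl, fun _ => rfl⟩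
  have hY : ∀ k, Relation.ReflTransGen (PosStep f) H₀ (Y k) := by
    intro k
    induction k with
    | zero => rw [hY0]
    | succ k ih => rw [hYs]; exact ih.trans (hnext (Y k) (task k) (pos_of_posStep ih hH₀)).1
  have hYn := fun k => hnext (Y k) (task k) (pos_of_posStep (hY k) hH₀)
  simp only [← hYs] at hYn
  have hYmono : ∀ {j k}, j ≤ k → (Y j).trace <:+ (Y k).trace := by
    intro j k hjk
    induction hjk with
    | refl => exact List.suffix_refl _
    | step _ ih => exact ih.trans (suffix_of_posStep (hYn _).1)
  have hYlen : ∀ k, H₀.trace.length + k ≤ (Y k).trace.length := by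
    intro k
    induction k with
    | zero => rw [hY0]; exact le_rfl
    | succ k ih =>
      have := (hYn k).2.1
      exact Nat.succ_le_of_lt (ih.trans_lt this)
  -- A round may comprise several events. Single events are recovered by keeping the oldest
  -- `H₀.trace.length + n` entries of the trace of `Y n`, which is long enough because each round
  -- adds at least one.
  obtain ⟨run, hrunY, hrunlen⟩ : ∃ run : ℕ → S.History, (∀ n, (run n).trace <:+ (Y n).trace) ∧
      ∀ n, (run n).trace.length = H₀.trace.length + n := by
    refine ⟨fun n => ⟨(Y n).trace.drop ((Y n).trace.length - (H₀.trace.length + n)),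
      (Y n).legal.of_suffix (List.drop_suffix _ _)⟩, fun n => List.drop_suffix _ _, fun n => ?_⟩
    have := hYlen n
    simp only [List.length_drop]
    omega
  -- The traces of the `Y k` form a chain of suffixes, so a suffix of one of them is determined by
  -- its length.
  have huniq : ∀ {G : S.History} {k n}, G.trace <:+ (Y k).trace →
      G.trace.length = H₀.trace.length + n → G = run n := by
    intro G k n hG hlen
    have h1 := hG.trans (hYmono (le_max_left k n))
    have h2 := (hrunY n).trans (hYmono (le_max_right k n))
    exact History.ext ((List.suffix_of_suffix_length_le h1 h2
      (by rw [hlen, hrunlen])).eq_of_length (by rw [hlen, hrunlen]))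
  have hstep : ∀ n, ∃ e : S.Event, S.unfold.Step (run n) e (run (n + 1)) := by
    intro n
    obtain ⟨⟨e, C⟩, l, hl⟩ := List.exists_cons_of_length_pos (l := (run (n + 1)).trace)
      (by rw [hrunlen]; omega)
    have hsuf : l <:+ (Y (n + 1)).trace :=
      (hl ▸ List.suffix_cons _ _ : l <:+ (run (n + 1)).trace).trans (hrunY (n + 1))
    have hlen : l.length = H₀.trace.length + n := by
      have := hrunlen (n + 1)
      rw [hl, List.length_cons] at this
      omega
    have : (⟨l, (Y (n + 1)).legal.of_suffix hsuf⟩ : S.History) = run n :=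
      huniq (k := n + 1) hsuf hlen
    refine ⟨e, ?_⟩
    change (run (n + 1)).trace = (e, S.last (run (n + 1)).trace) :: (run n).trace
    rw [hl, ← this]
    rfl
  choose ev hev using hstep
  have hoccurs : ∀ {φ : S.Event} {n k : ℕ}, n ≤ k → (∃ G : S.History, (run n).trace <:+ G.trace ∧
      ∃ G' : S.History, S.unfold.Step G φ G' ∧ G'.trace <:+ (Y k).trace) → ∃ j ≥ n, ev j = φ := by
    rintro φ n k - ⟨G, hG, G', hs, hG'⟩
    have hs' : G'.trace = (φ, G'.current) :: G.trace := hs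
    have hlen := hG.length_le
    rw [hrunlen] at hlen
    obtain ⟨j, hj⟩ := Nat.exists_eq_add_of_le hlen
    have h1 : G = run (n + j) :=
      huniq (k := k) ((hs' ▸ List.suffix_cons _ _ : G.trace <:+ G'.trace).trans hG') (by omega)
    have h2 : G' = run (n + j + 1) := huniq (k := k) hG' (by rw [hs', List.length_cons]; omega)
    refine ⟨n + j, by omega, ?_⟩
    have h3 : (run (n + j + 1)).trace = _ := hev (n + j)
    rw [← h2, ← h1, hs'] at h3
    simpa using (congrArg (fun l => l.head?.map Prod.fst) h3).symm
  refine ⟨run, ev, (huniq (k := 0) (by rw [hY0]) rfl).symm, hev, fun n => ?_, ?_⟩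
  · refine pos_of_posStep (posStep_of_suffix (hY n) ?_ (hrunY n)) hH₀
    exact List.suffix_of_suffix_length_le (hY0 ▸ hYmono (Nat.zero_le n)) (hrunY n)
      (by rw [hrunlen]; omega)
  -- If `φ` never occurred from `n` on, it would remain possible by persistence, and a later round
  -- with task `φ` would carry it out.
  · intro φ n hφ
    by_contra hno
    push Not at hno
    have hen : ∀ j, Enabled (run (n + j)) φ := by
      intro j
      induction j with
      | zero => exact hφ
      | succ j ih => exact hpers _ _ _ _ ih (hev (n + j)) (hno _ (by omega))
    obtain ⟨k, hk, hkφ⟩ := htask φ n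
    have hlen := hYlen k
    obtain ⟨j, hj⟩ := Nat.exists_eq_add_of_le (show H₀.trace.length + n ≤ (Y k).trace.length by omega)
    have hYk : Y k = run (n + j) := huniq (k := k) (List.suffix_refl _) (by omega)
    obtain ⟨G, hG, hs⟩ := (hYn k).2.2 (by rw [hkφ, hYk]; exact hen j)
    rw [hkφ] at hs
    obtain ⟨i, hi, hev'⟩ := hoccurs (φ := φ) (n := n) (k := k + 1) (by omega)
      ⟨G, ((List.suffix_of_suffix_length_le ((hrunY n).trans (hYmono hk)) (List.suffix_refl _)
        (by rw [hrunlen]; omega))).trans hG, Y (k + 1), hs,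
        List.suffix_refl _⟩
    exact hno i hi hev'

end FairRun

end DistSystem

/-! ### Message passing as a machine that rewrites a row -/

instance : Finite Turing.Dir :=
  Finite.of_injective (fun d : Turing.Dir => match d with | .left => true | .right => false) (by
    intro d d' h
    cases d <;> cases d' <;> simp_all)

/-- The opposite direction. -/
def Turing.Dir.opp : Turing.Dir → Turing.Dir
  | .left => .right
  | .right => .left

/-- The half of a tape beyond the head, in a direction. -/
def Turing.Tape.side {Γ : Type} [Inhabited Γ] (T : Turing.Tape Γ) : Turing.Dir → Turing.ListBlank Γ
  | .left => T.left
  | .right => T.right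

namespace MessagePassing

variable (M : MessagePassing)

instance : Finite M.Event := by
  have := M.finite_msg
  refine Finite.of_injective (fun e : M.Event => match e with
    | .comp i => (Sum.inl i : Bool ⊕ Bool × M.Msg)
    | .deliver i m => .inr (i, m)) ?_
  intro e e' h
  cases e <;> cases e' <;> simp_all

/-- The control states and scanned symbols of the processes, and the messages in transit that are
present at least once. -/
abbrev Ctrl : Type := (Bool → M.State × M.Symbol) × Set (Bool × M.Msg)

/-- A message with its addressee; the flag tells whether it has been delivered. -/
abbrev Letter : Type := Bool × Bool × M.Msg

/-- A cell contains at most one symbol, which belongs to the half tape of a process in a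
direction, and at most one message. -/
abbrev Cell : Type := Option (Bool × Turing.Dir × M.Symbol) × Option M.Letter

variable {M}

/-- The messages that an event removes from where they are. -/
def Wanted : M.Event → M.Letter → Prop
  | .comp i, x => x.1 = i ∧ x.2.1 = true
  | .deliver i m, x => x = (i, false, m)

open Classical in
/-- The forward sweep removes the first message that the event removes. -/
noncomputable def sweepMsg (q : M.Ctrl × M.Event × Option M.Msg) (c : M.Cell) :
    (M.Ctrl × M.Event × Option M.Msg) × M.Cell :=
  if q.2.2 = none ∧ ∃ x ∈ c.2, Wanted q.2.1 x then
    ((q.1, q.2.1, c.2.map fun x => x.2.2), (c.1, none))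
  else (q, c)

/-- At the end of the row the event takes effect; the symbol that has been left and the message
that has been sent or delivered are put into a new cell. -/
def apply (q : M.Ctrl × M.Event × Option M.Msg) :
    (M.Event × Option (Bool × Turing.Dir) × M.Ctrl) × M.Cell :=
  match q.2.1 with
  | .deliver i m => ((.deliver i m, none, q.1.1, ∅), none, some (i, true, m))
  | .comp i =>
    match M.program i (q.1.1 i).1 (q.1.1 i).2 q.2.2 with
    | none => ((.comp i, none, q.1.1, ∅), none, none)
    | some (s, a, none, o) =>
      ((.comp i, none, Function.update q.1.1 i (s, a), ∅), none, o.map fun m => (!i, false, m))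
    | some (s, a, some d, o) =>
      ((.comp i, some (i, d), Function.update q.1.1 i (s, default), ∅),
        some (i, d.opp, a), o.map fun m => (!i, false, m))

/-- The messages in transit which the cell contains. -/
def inTransit (c : M.Cell) : Set (Bool × M.Msg) := {x | c.2 = some (x.1, false, x.2)}

open Classical in
/-- The backward sweep fetches the symbol that is scanned next, and lists the messages in
transit. -/
noncomputable def sweepSymbol (q : M.Event × Option (Bool × Turing.Dir) × M.Ctrl) (c : M.Cell) :
    (M.Event × Option (Bool × Turing.Dir) × M.Ctrl) × M.Cell :=
  match c.1 with
  | none => ((q.1, q.2.1, q.2.2.1, q.2.2.2 ∪ inTransit c), c)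
  | some (i, d, a) =>
    if q.2.1 = some (i, d) then
      ((q.1, none, Function.update q.2.2.1 i ((q.2.2.1 i).1, a), q.2.2.2 ∪ inTransit c), none, c.2)
    else ((q.1, q.2.1, q.2.2.1, q.2.2.2 ∪ inTransit c), c)

variable (M) in
/-- The initial content of a half tape, nearest symbol first. -/
noncomputable def initSide (i : Bool) (d : Turing.Dir) : List M.Symbol :=
  (Quot.exists_rep ((M.initTape i).side d)).choose

variable (M) in
theorem mk_initSide (i : Bool) (d : Turing.Dir) :
    Turing.ListBlank.mk (M.initSide i d) = (M.initTape i).side d :=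
  (Quot.exists_rep ((M.initTape i).side d)).choose_spec

variable (M) in
/-- Cells that contain the initial content of a half tape. -/
noncomputable def initCells (i : Bool) (d : Turing.Dir) : List M.Cell :=
  (M.initSide i d).reverse.map fun a => (some (i, d, a), none)

variable (M) in
/-- The message-passing system as a machine that rewrites a row of cells. -/
noncomputable abbrev machine : SweepMachine where
  Ctrl := M.Ctrl
  Event := M.Event
  Fwd := M.Ctrl × M.Event × Option M.Msg
  Bwd := M.Event × Option (Bool × Turing.Dir) × M.Ctrl
  Cell := M.Cell
  finite_ctrl := by
    have := M.finite_state; have := M.finite_symbol; have := M.finite_msg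
    infer_instance
  finite_event := inferInstance
  finite_fwd := by
    have := M.finite_state; have := M.finite_symbol; have := M.finite_msg
    infer_instance
  finite_bwd := by
    have := M.finite_state; have := M.finite_symbol; have := M.finite_msg
    infer_instance
  finite_cell := by
    have := M.finite_symbol; have := M.finite_msg
    infer_instance
  enabled := fun K => {e | match e with
    | .comp _ => True
    | .deliver i m => (i, m) ∈ K.2}
  start := fun K e => (K, e, none)
  fwd := sweepMsg
  turn := apply
  bwd := sweepSymbol
  finish := fun q => q.2.2
  initCtrl := (fun i => (M.initState i, (M.initTape i).head), ∅)
  initRow := M.initCells false .left ++ M.initCells false .right ++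
    (M.initCells true .left ++ M.initCells true .right)

/-! ### What a row represents -/

open Classical in
/-- The messages to a process that have, or have not, been delivered. -/
noncomputable def letters (i b : Bool) (row : List M.Cell) : List M.Msg :=
  row.filterMap fun c => c.2.bind fun x => if x.1 = i ∧ x.2.1 = b then some x.2.2 else none

open Classical in
/-- The content of a half tape, nearest symbol first. -/
noncomputable def symbols (i : Bool) (d : Turing.Dir) (row : List M.Cell) : List M.Symbol :=
  (row.filterMap fun c => c.1.bind fun x => if x.1 = i ∧ x.2.1 = d then some x.2.2 else none).reverse

theorem letters_append (i b : Bool) (l l' : List M.Cell) :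
    letters i b (l ++ l') = letters i b l ++ letters i b l' := by
  simp [letters]

theorem symbols_append (i : Bool) (d : Turing.Dir) (l l' : List M.Cell) :
    symbols i d (l ++ l') = symbols i d l' ++ symbols i d l := by
  simp [symbols]

theorem letters_cons (i b : Bool) (c : M.Cell) (l : List M.Cell) :
    letters i b (c :: l) = letters i b [c] ++ letters i b l := letters_append i b [c] l

theorem symbols_cons (i : Bool) (d : Turing.Dir) (c : M.Cell) (l : List M.Cell) :
    symbols i d (c :: l) = symbols i d l ++ symbols i d [c] := symbols_append i d [c] l

theorem letters_none (i b : Bool) (s : Option (Bool × Turing.Dir × M.Symbol)) :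
    letters i b [((s, none) : M.Cell)] = [] := by simp [letters]

theorem letters_some (i b : Bool) (s : Option (Bool × Turing.Dir × M.Symbol)) (x : M.Letter) :
    letters i b [((s, some x) : M.Cell)] = if x.1 = i ∧ x.2.1 = b then [x.2.2] else [] := by
  split_ifs with h <;> simp [letters, h]

theorem symbols_none (i : Bool) (d : Turing.Dir) (x : Option M.Letter) :
    symbols i d [((none, x) : M.Cell)] = [] := by simp [symbols]

theorem symbols_some (i : Bool) (d : Turing.Dir) (s : Bool × Turing.Dir × M.Symbol)
    (x : Option M.Letter) :
    symbols i d [((some s, x) : M.Cell)] = if s.1 = i ∧ s.2.1 = d then [s.2.2] else [] := by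
  split_ifs with h <;> simp [symbols, h]

theorem letters_congr (i b : Bool) {l l' : List M.Cell} (h : l.map Prod.snd = l'.map Prod.snd) :
    letters i b l = letters i b l' := by
  have key : ∀ l : List M.Cell, letters i b l = (l.map Prod.snd).filterMap fun c =>
      c.bind fun x => if x.1 = i ∧ x.2.1 = b then some x.2.2 else none := by
    intro l
    rw [List.filterMap_map]
    simp only [letters]
    congr 1
  rw [key, key, h]

theorem symbols_congr (i : Bool) (d : Turing.Dir) {l l' : List M.Cell}
    (h : l.map Prod.fst = l'.map Prod.fst) : symbols i d l = symbols i d l' := by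
  classical
  have key : ∀ l : List M.Cell, symbols i d l = ((l.map Prod.fst).filterMap fun c =>
      c.bind fun x => if x.1 = i ∧ x.2.1 = d then some x.2.2 else none).reverse := by
    intro l
    rw [List.filterMap_map]
    simp only [symbols]
    congr 2
  rw [key, key, h]

/-! ### The forward sweep -/

theorem sweepFwd_found (K : M.Ctrl) (e : M.Event) (m : M.Msg) (row : List M.Cell) :
    M.machine.sweepFwd (K, e, some m) row = ((K, e, some m), row) := by
  induction row with
  | nil => rfl
  | cons c l ih =>
    have : sweepMsg (K, e, some m) c = ((K, e, some m), c) := by simp [sweepMsg]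
    simp only [SweepMachine.sweepFwd, this, ih]

theorem sweepFwd_cons_wanted (K : M.Ctrl) (e : M.Event) {c : M.Cell} {x : M.Letter}
    (hc : c.2 = some x) (hx : Wanted e x) (row : List M.Cell) :
    M.machine.sweepFwd (K, e, none) (c :: row) = ((K, e, some x.2.2), (c.1, none) :: row) := by
  have : sweepMsg (K, e, none) c = ((K, e, some x.2.2), (c.1, none)) := by simp [sweepMsg, hc, hx]
  simp only [SweepMachine.sweepFwd, this, sweepFwd_found]

theorem sweepFwd_cons_unwanted (K : M.Ctrl) (e : M.Event) {c : M.Cell}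
    (hc : ∀ x ∈ c.2, ¬ Wanted e x) (row : List M.Cell) :
    M.machine.sweepFwd (K, e, none) (c :: row) =
      ((M.machine.sweepFwd (K, e, none) row).1, c :: (M.machine.sweepFwd (K, e, none) row).2) := by
  have : sweepMsg (K, e, none) c = ((K, e, none), c) := by
    unfold sweepMsg
    rw [if_neg]
    rintro ⟨-, x, hx, hw⟩
    exact hc x hx hw
  simp only [SweepMachine.sweepFwd, this]

/-- The forward sweep touches messages only; the half tapes pass through unchanged. -/
theorem sweepFwd_fst (K : M.Ctrl) (e : M.Event) (row : List M.Cell) :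
    ∃ g, (M.machine.sweepFwd (K, e, none) row).1 = (K, e, g) ∧
      (M.machine.sweepFwd (K, e, none) row).2.map Prod.fst = row.map Prod.fst := by
  induction row with
  | nil => exact ⟨none, rfl, rfl⟩
  | cons c l ih =>
    by_cases h : ∃ x ∈ c.2, Wanted e x
    · obtain ⟨x, hx, hw⟩ := h
      rw [sweepFwd_cons_wanted K e hx hw]
      exact ⟨_, rfl, rfl⟩
    · rw [sweepFwd_cons_unwanted K e (fun x hx hw => h ⟨x, hx, hw⟩)]
      obtain ⟨g, h1, h2⟩ := ih
      exact ⟨g, h1, by simp [h2]⟩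

/-- Delivered messages stand in the order of delivery, so removing the leftmost one addressed to `i`
takes the oldest message from its inbuffer. -/
theorem sweepFwd_comp (K : M.Ctrl) (i : Bool) (row : List M.Cell) :
    (M.machine.sweepFwd (K, .comp i, none) row).1 = (K, .comp i, (letters i true row).head?) ∧
    ∀ j b, letters j b (M.machine.sweepFwd (K, .comp i, none) row).2 =
      if j = i ∧ b = true then (letters j b row).tail else letters j b row := by
  induction row with
  | nil =>
    refine ⟨rfl, fun j b => ?_⟩
    split_ifs <;> rfl
  | cons c l ih =>
    obtain ⟨s, x⟩ := c
    by_cases h : ∃ y ∈ x, Wanted (.comp i) y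
    · obtain ⟨⟨j', b', m⟩, rfl, hw⟩ := h
      rw [sweepFwd_cons_wanted K _ rfl hw]
      obtain ⟨h1, h2⟩ := hw
      simp only at h1 h2
      subst h1 h2
      refine ⟨by rw [letters_cons, letters_some]; simp, fun j b => ?_⟩
      simp only
      rw [letters_cons, letters_none, letters_cons j b (s, _), letters_some]
      simp only
      by_cases hjb : j = j' ∧ b = true
      · obtain ⟨rfl, rfl⟩ := hjb
        simp
      · rw [if_neg hjb, if_neg (fun h => hjb ⟨h.1.symm, h.2.symm⟩)]
    · have hx : ∀ y ∈ x, ¬ Wanted (.comp i) y := fun y hy hw => h ⟨y, hy, hw⟩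
      rw [sweepFwd_cons_unwanted K _ hx]
      have h0 : letters i true [((s, x) : M.Cell)] = [] := by
        cases x with
        | none => rw [letters_none]
        | some y => exact (letters_some i true s y).trans (if_neg (hx y rfl))
      refine ⟨by rw [letters_cons, h0]; exact ih.1, fun j b => ?_⟩
      refine (letters_cons j b (s, x) _).trans ?_
      rw [ih.2, letters_cons j b (s, x) l]
      split_ifs with hjb
      · obtain ⟨rfl, rfl⟩ := hjb
        rw [h0]
        rfl
      · rfl

/-- Messages in transit are unordered, so it does not matter which copy of `m` is removed; hence the
equation between multisets. -/
theorem sweepFwd_deliver (K : M.Ctrl) (i : Bool) (m : M.Msg) (row : List M.Cell)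
    (hm : m ∈ letters i false row) :
    ((letters i false row : List M.Msg) : Multiset M.Msg) =
      m ::ₘ (letters i false (M.machine.sweepFwd (K, .deliver i m, none) row).2 : Multiset M.Msg) ∧
    ∀ j b, (j ≠ i ∨ b = true) → letters j b (M.machine.sweepFwd (K, .deliver i m, none) row).2 =
      letters j b row := by
  induction row with
  | nil => simp [letters] at hm
  | cons c l ih =>
    obtain ⟨s, x⟩ := c
    by_cases h : ∃ y ∈ x, Wanted (.deliver i m) y
    · obtain ⟨y, rfl, hw⟩ := h
      rw [sweepFwd_cons_wanted K _ rfl hw]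
      obtain rfl : y = (i, false, m) := hw
      refine ⟨?_, fun j b hjb => ?_⟩
      · rw [letters_cons, letters_some, letters_cons i false (s, none), letters_none]
        simp
      · simp only
        rw [letters_cons, letters_none, letters_cons j b (s, _), letters_some, if_neg]
        rintro ⟨rfl, rfl⟩
        simp at hjb
    · have hx : ∀ y ∈ x, ¬ Wanted (.deliver i m) y := fun y hy hw => h ⟨y, hy, hw⟩
      rw [sweepFwd_cons_unwanted K _ hx]
      have h0 : m ∉ letters i false [((s, x) : M.Cell)] := by
        cases x with
        | none => rw [letters_none]; simp
        | some y =>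
          rw [letters_some]
          split_ifs with hy
          · intro hm'
            refine hx y rfl ?_
            obtain ⟨y1, y2, y3⟩ := y
            obtain ⟨rfl, rfl⟩ := hy
            rw [List.mem_singleton.1 hm']
            rfl
          · simp
      rw [letters_cons, List.mem_append] at hm
      obtain ⟨h1, h2⟩ := ih (hm.resolve_left h0)
      refine ⟨?_, fun j b hjb => ?_⟩
      · simp only
        rw [letters_cons i false (s, x) l, letters_cons i false (s, x) (Prod.snd _),
          ← Multiset.coe_add, ← Multiset.coe_add, h1, Multiset.add_cons]
      · simp only
        rw [letters_cons, h2 j b hjb, ← letters_cons]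

/-! ### The backward sweep -/

theorem mem_letters_cons {i : Bool} {m : M.Msg} {c : M.Cell} {l : List M.Cell} :
    m ∈ letters i false (c :: l) ↔ m ∈ letters i false l ∨ (i, m) ∈ inTransit c := by
  rw [letters_cons, List.mem_append, or_comm]
  refine or_congr_right ?_
  obtain ⟨s, x⟩ := c
  cases x with
  | none => simp [letters_none, inTransit]
  | some y =>
    obtain ⟨j, b, m'⟩ := y
    rw [letters_some]
    simp only [inTransit, Set.mem_ofPred_eq, Option.some.injEq, Prod.mk.injEq]
    split_ifs with h
    · simp [h, eq_comm]
    · simp only [List.not_mem_nil, false_iff]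
      tauto

theorem sweepBwd_none (e : M.Event) (v : Bool → M.State × M.Symbol) (P : Set (Bool × M.Msg))
    (row : List M.Cell) :
    M.machine.sweepBwd (e, none, v, P) row =
      ((e, none, v, P ∪ {x | x.2 ∈ letters x.1 false row}), row) := by
  induction row with
  | nil => simp [SweepMachine.sweepBwd, letters]
  | cons c l ih =>
    have : ∀ P, sweepSymbol (e, none, v, P) c = ((e, none, v, P ∪ inTransit c), c) := by
      intro P
      unfold sweepSymbol
      split
      · rfl
      · simp
    simp only [SweepMachine.sweepBwd, ih, this, Set.union_assoc]
    congr 5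
    ext ⟨i, m⟩
    simp [mem_letters_cons]

/-- The rightmost symbol of a half tape is nearest to the head, and the sweep meets it first. If the
half tape is exhausted, the request `p` survives and the blank entered in advance (`hv`) is the
right symbol. -/
theorem sweepBwd_some (e : M.Event) (i : Bool) (d : Turing.Dir) (v : Bool → M.State × M.Symbol)
    (hv : (v i).2 = default) (P : Set (Bool × M.Msg)) (row : List M.Cell) :
    ∃ p, (M.machine.sweepBwd (e, some (i, d), v, P) row).1 =
        (e, p, Function.update v i ((v i).1, (symbols i d row).headI),
          P ∪ {x | x.2 ∈ letters x.1 false row}) ∧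
      (M.machine.sweepBwd (e, some (i, d), v, P) row).2.map Prod.snd = row.map Prod.snd ∧
      (p = if symbols i d row = [] then some (i, d) else none) ∧
      ∀ j d', symbols j d' (M.machine.sweepBwd (e, some (i, d), v, P) row).2 =
        if j = i ∧ d' = d then (symbols j d' row).tail else symbols j d' row := by
  have hself : Function.update v i ((v i).1, default) = v := by
    rw [← hv]
    exact Function.update_eq_self i v
  induction row with
  | nil =>
    refine ⟨some (i, d), ?_, rfl, by simp [symbols], fun j d' => ?_⟩
    · simp [SweepMachine.sweepBwd, letters, symbols, hself]
    · simp [SweepMachine.sweepBwd, symbols]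
  | cons c l ih =>
    obtain ⟨p, h1, h2, h3, h4⟩ := ih
    obtain ⟨s, x⟩ := c
    have hP : P ∪ {x | x.2 ∈ letters x.1 false l} ∪ inTransit (s, x) =
        P ∪ {y | y.2 ∈ letters y.1 false ((s, x) :: l)} := by
      rw [Set.union_assoc]
      congr 1
      ext ⟨i, m⟩
      simp [mem_letters_cons]
    -- The current cell answers the request exactly if it holds a symbol of this half tape and no
    -- cell to its right does.
    by_cases hc : symbols i d l = [] ∧ ∃ a, s = some (i, d, a)
    · obtain ⟨hl, a, rfl⟩ := hc
      rw [if_pos hl] at h3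
      subst h3
      have hsw : M.machine.sweepBwd (e, some (i, d), v, P) ((some (i, d, a), x) :: l) =
          ((e, none, Function.update v i ((v i).1, a),
            P ∪ {x | x.2 ∈ letters x.1 false l} ∪ inTransit (some (i, d, a), x)),
            (none, x) :: (M.machine.sweepBwd (e, some (i, d), v, P) l).2) := by
        simp [SweepMachine.sweepBwd, h1, sweepSymbol]
      have hsym : symbols i d ((some (i, d, a), x) :: l) = [a] := by
        rw [symbols_cons, hl, symbols_some]
        simp
      rw [hsw, hsym, hP]
      refine ⟨none, rfl, by simp [h2], by simp, fun j d' => ?_⟩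
      simp only
      rw [symbols_cons, symbols_none, h4, symbols_cons j d' (some _, _), symbols_some]
      simp only
      by_cases hjd : j = i ∧ d' = d
      · obtain ⟨rfl, rfl⟩ := hjd
        simp [hl]
      · rw [if_neg hjd, if_neg hjd, if_neg (fun h => hjd ⟨h.1.symm, h.2.symm⟩)]
    · have hsw : M.machine.sweepBwd (e, some (i, d), v, P) ((s, x) :: l) =
          ((e, p, Function.update v i ((v i).1, (symbols i d l).headI),
            P ∪ {x | x.2 ∈ letters x.1 false l} ∪ inTransit (s, x)),
            (s, x) :: (M.machine.sweepBwd (e, some (i, d), v, P) l).2) := by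
        simp only [SweepMachine.sweepBwd, h1]
        cases s with
        | none => rfl
        | some s =>
          obtain ⟨j, d', a⟩ := s
          simp only [sweepSymbol]
          rw [if_neg]
          rintro rfl
          split_ifs at h3 with hl
          · obtain ⟨rfl, rfl⟩ := by simpa using h3
            exact hc ⟨hl, a, rfl⟩
      have hsym : symbols i d l = [] → symbols i d [((s, x) : M.Cell)] = [] := by
        intro hl
        cases s with
        | none => rw [symbols_none]
        | some s =>
          rw [symbols_some, if_neg]
          rintro ⟨rfl, rfl⟩
          exact hc ⟨hl, s.2.2, rfl⟩
      rw [hsw, hP]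
      refine ⟨p, ?_, by simp [h2], ?_, fun j d' => ?_⟩
      · rw [symbols_cons]
        cases hl : symbols i d l with
        | nil => rw [hsym hl, List.nil_append]
        | cons b t => rfl
      · rw [h3, symbols_cons]
        cases hl : symbols i d l with
        | nil => rw [hsym hl, List.nil_append]
        | cons b t => simp
      · refine (symbols_cons j d' (s, x) _).trans ?_
        rw [h4, symbols_cons j d' (s, x) l]
        split_ifs with hjd
        · obtain ⟨rfl, rfl⟩ := hjd
          cases hl : symbols j d' l with
          | nil => rw [hsym hl]; rfl
          | cons b t => rfl
        · rfl

/-! ### The row machine follows the message-passing system -/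

/-- The control state and the row represent the configuration. -/
structure Represents (K : M.Ctrl) (row : List M.Cell) (C : M.Config) : Prop where
  view : K.1 = M.view C
  present : K.2 = {x | x.2 ∈ letters x.1 false row}
  side : ∀ i d, (C.tape i).side d = Turing.ListBlank.mk (symbols i d row)
  inbuf : ∀ i, C.inbuf i = letters i true row
  transit : ∀ i, C.transit i = letters i false row

theorem symbols_initCells (i j : Bool) (d d' : Turing.Dir) :
    symbols i d (M.initCells j d') = if j = i ∧ d' = d then M.initSide i d else [] := by
  unfold symbols initCells
  rw [List.filterMap_map]
  split_ifs with h
  · obtain ⟨rfl, rfl⟩ := h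
    simp
  · simp [h]

theorem letters_initCells (i b j : Bool) (d : Turing.Dir) : letters i b (M.initCells j d) = [] := by
  unfold letters initCells
  rw [List.filterMap_map]
  simp

theorem represents_init :
    Represents M.machine.initCtrl M.machine.initRow (M.system.start : M.Config) := by
  have hl : ∀ i b, letters i b M.machine.initRow = [] := by
    intro i b
    simp only [letters_append, letters_initCells, List.append_nil]
  refine ⟨rfl, ?_, fun i d => ?_, fun i => (hl i true).symm, fun i => ?_⟩
  · ext x
    change x ∈ (∅ : Set (Bool × M.Msg)) ↔ x.2 ∈ letters x.1 false M.machine.initRow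
    rw [hl]
    simp
  · change (M.initTape i).side d = _
    rw [← mk_initSide]
    congr 1
    simp only [symbols_append, symbols_initCells]
    cases i <;> cases d <;> simp
  · rw [hl]
    rfl

theorem side_act_none (T : Turing.Tape M.Symbol) (a : M.Symbol) (d : Turing.Dir) :
    (M.act T a none).side d = T.side d := by
  cases d <;> rfl

theorem side_act_some (T : Turing.Tape M.Symbol) (a : M.Symbol) (d d' : Turing.Dir) :
    (M.act T a (some d)).side d' = if d' = d then (T.side d).tail else (T.side d').cons a := by
  cases d <;> cases d' <;> rfl

theorem head_act_some (T : Turing.Tape M.Symbol) (a : M.Symbol) (d : Turing.Dir) :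
    (M.act T a (some d)).head = (T.side d).head := by
  cases d <;> rfl

theorem letters_map (i b j : Bool) (s : Option (Bool × Turing.Dir × M.Symbol)) (o : Option M.Msg) :
    letters i b [((s, o.map fun m => (j, false, m)) : M.Cell)] =
      if j = i ∧ b = false then o.toList else [] := by
  cases o with
  | none => rw [Option.map_none, letters_none]; simp
  | some m =>
    rw [Option.map_some, letters_some]
    cases b <;> simp

end MessagePassing

/-! ### One event of the system as one double sweep -/

namespace MessagePassing

variable {M : MessagePassing} {K : M.Ctrl} {row : List M.Cell} {C C' : M.Config}

namespace Represents

theorem enabled_iff (h : Represents K row C) {i : Bool} {m : M.Msg} :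
    .deliver i m ∈ M.machine.enabled K ↔ m ∈ C.transit i := by
  change (i, m) ∈ K.2 ↔ _
  rw [h.present, h.transit]
  simp

/-- One copy of `m` leaves transit in the forward sweep and reappears as delivered in the new last
cell, which is the end of the inbuffer. -/
theorem deliver (h : Represents K row C) {i : Bool} {m : M.Msg} {s : Multiset M.Msg}
    (hs : C.transit i = m ::ₘ s) :
    (M.machine.swept K row (.deliver i m)).1.1 = .deliver i m ∧
    Represents (M.machine.swept K row (.deliver i m)).1.2.2 (M.machine.swept K row (.deliver i m)).2
      { state := C.state
        tape := C.tape
        inbuf := Function.update C.inbuf i (C.inbuf i ++ [m])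
        transit := Function.update C.transit i s } := by
  have hm : m ∈ letters i false row := by
    have : m ∈ C.transit i := by simp [hs]
    rw [h.transit] at this
    simpa using this
  obtain ⟨g, hg, hfst⟩ := sweepFwd_fst K (.deliver i m) row
  obtain ⟨hrem, hother⟩ := sweepFwd_deliver K i m row hm
  have hturn : M.machine.turned K row (.deliver i m) =
      ((.deliver i m, none, K.1, ∅), none, some (i, true, m)) := by
    simp only [SweepMachine.turned]
    rw [hg]
    rfl
  have hswept : M.machine.swept K row (.deliver i m) =
      M.machine.sweepBwd (.deliver i m, none, K.1, ∅) (M.machine.midRow K row (.deliver i m)) := by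
    unfold SweepMachine.swept
    rw [hturn]
  rw [sweepBwd_none] at hswept
  rw [hswept]
  have hmid : M.machine.midRow K row (.deliver i m) =
      (M.machine.sweepFwd (K, .deliver i m, none) row).2 ++ [(none, some (i, true, m))] := by
    simp only [SweepMachine.midRow]
    rw [hturn]
  have hlet : ∀ j b, letters j b (M.machine.midRow K row (.deliver i m)) =
      letters j b (M.machine.sweepFwd (K, .deliver i m, none) row).2 ++
        if i = j ∧ true = b then [m] else [] := fun j b => by
    rw [hmid, letters_append, letters_some]
  refine ⟨rfl, h.view, ?_, fun j d => ?_, fun j => ?_, fun j => ?_⟩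
  · exact Set.empty_union _
  · simp only
    rw [h.side, hmid, symbols_append, symbols_none, List.nil_append]
    congr 1
    exact (symbols_congr j d hfst).symm
  · simp only
    rw [hlet, hother j true (Or.inr rfl)]
    by_cases hj : j = i
    · subst hj
      simp [h.inbuf]
    · simp [hj, Ne.symm hj, h.inbuf]
  · simp only
    rw [hlet]
    by_cases hj : j = i
    · subst hj
      rw [h.transit, hrem, Multiset.cons_inj_right] at hs
      simp [hs]
    · rw [hother j false (Or.inl hj)]
      simp [hj, h.transit]

/-- A move in direction `d` pushes the written symbol onto the half tape opposite to `d` and pops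
the half tape in direction `d`. Without a move the written symbol just stays in the control. -/
theorem comp (h : Represents K row C) {i : Bool} {q : M.State} {a : M.Symbol}
    {d : Option Turing.Dir} {o : Option M.Msg} (ha : M.action C i = some (q, a, d, o)) :
    (M.machine.swept K row (.comp i)).1.1 = .comp i ∧
    Represents (M.machine.swept K row (.comp i)).1.2.2 (M.machine.swept K row (.comp i)).2
      { state := Function.update C.state i q
        tape := Function.update C.tape i (M.act (C.tape i) a d)
        inbuf := Function.update C.inbuf i (C.inbuf i).tail
        transit := Function.update C.transit (!i) (M.post (C.transit (!i)) o) } := by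
  obtain ⟨hg, hlet⟩ := sweepFwd_comp K i row
  obtain ⟨g, -, hfst⟩ := sweepFwd_fst K (.comp i) row
  have hprog : M.program i (K.1 i).1 (K.1 i).2 (letters i true row).head? = some (q, a, d, o) := by
    rw [h.view, ← h.inbuf]
    exact ha
  -- what does not depend on the move of the head
  have hmsg : ∀ {s : Option (Bool × Turing.Dir × M.Symbol)} {row' : List M.Cell},
      row'.map Prod.snd = ((M.machine.sweepFwd (K, .comp i, none) row).2 ++
        [(s, o.map fun m => (!i, false, m))]).map Prod.snd →
      (∀ j, Function.update C.inbuf i (C.inbuf i).tail j = letters j true row') ∧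
      ∀ j, Function.update C.transit (!i) (M.post (C.transit (!i)) o) j = letters j false row' := by
    intro s row' hrow'
    have hl := fun j b => letters_congr j b hrow'
    simp only [letters_append, hlet, letters_map] at hl
    refine ⟨fun j => ?_, fun j => ?_⟩
    · rw [hl]
      by_cases hj : j = i
      · subst hj
        simp [h.inbuf]
      · simp [hj, h.inbuf]
    · rw [hl]
      by_cases hj : j = !i
      · subst hj
        cases o with
        | none => simp [post, h.transit]
        | some m =>
          simp only [post, h.transit, Function.update_self]
          simp [← Multiset.coe_add]
          rw [add_comm, Multiset.singleton_add, Multiset.cons_coe]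
      · have hj' : ¬ (!i) = j := fun e => hj e.symm
        simp [hj, hj', h.transit]
  have hsym : ∀ j d', symbols j d' (M.machine.sweepFwd (K, .comp i, none) row).2 =
      symbols j d' row := fun j d' => symbols_congr j d' hfst
  cases d with
  | none =>
    have hturn : M.machine.turned K row (.comp i) = ((.comp i, none,
        Function.update K.1 i (q, a), ∅), none, o.map fun m => (!i, false, m)) := by
      simp only [SweepMachine.turned]
      rw [hg]
      simp only [apply, hprog]
    have hmid : M.machine.midRow K row (.comp i) = (M.machine.sweepFwd (K, .comp i, none) row).2 ++
        [(none, o.map fun m => (!i, false, m))] := by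
      simp only [SweepMachine.midRow]
      rw [hturn]
    have hswept : M.machine.swept K row (.comp i) = M.machine.sweepBwd
        (.comp i, none, Function.update K.1 i (q, a), ∅) (M.machine.midRow K row (.comp i)) := by
      unfold SweepMachine.swept
      rw [hturn]
    rw [sweepBwd_none] at hswept
    rw [hswept]
    obtain ⟨hin, htr⟩ := hmsg (row' := M.machine.midRow K row (.comp i)) (by rw [hmid])
    refine ⟨rfl, ?_, Set.empty_union _, fun j d' => ?_, hin, htr⟩
    · funext j
      simp only [MessagePassing.view]
      by_cases hj : j = i
      · subst hj
        simp [act, Turing.Tape.write]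
      · simp [hj, h.view, MessagePassing.view]
    · simp only
      rw [hmid, symbols_append, symbols_none, List.nil_append, hsym, ← h.side]
      by_cases hj : j = i
      · subst hj
        simp [side_act_none]
      · simp [hj]
  | some d =>
    have hturn : M.machine.turned K row (.comp i) = ((.comp i, some (i, d),
        Function.update K.1 i (q, default), ∅), some (i, d.opp, a),
        o.map fun m => (!i, false, m)) := by
      simp only [SweepMachine.turned]
      rw [hg]
      simp only [apply, hprog]
    have hmid : M.machine.midRow K row (.comp i) = (M.machine.sweepFwd (K, .comp i, none) row).2 ++
        [(some (i, d.opp, a), o.map fun m => (!i, false, m))] := by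
      simp only [SweepMachine.midRow]
      rw [hturn]
    obtain ⟨p, h1, h2, -, h4⟩ := sweepBwd_some (.comp i) i d (Function.update K.1 i (q, default))
      (by simp) ∅ (M.machine.midRow K row (.comp i))
    have hswept : M.machine.swept K row (.comp i) = M.machine.sweepBwd (.comp i, some (i, d),
        Function.update K.1 i (q, default), ∅) (M.machine.midRow K row (.comp i)) := by
      unfold SweepMachine.swept
      rw [hturn]
    rw [hswept, h1]
    obtain ⟨hin, htr⟩ := hmsg (h2.trans (by rw [hmid]))
    have hsymmid : ∀ j d', symbols j d' (M.machine.midRow K row (.comp i)) =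
        (if i = j ∧ d.opp = d' then [a] else []) ++ symbols j d' row := fun j d' => by
      rw [hmid, symbols_append, symbols_some, hsym]
    -- The appended cell belongs to the other half tape, so it cannot be the one that is popped.
    have hne : d.opp ≠ d := by cases d <;> simp [Turing.Dir.opp]
    refine ⟨rfl, ?_, ?_, fun j d' => ?_, hin, htr⟩
    · funext j
      simp only [MessagePassing.view]
      by_cases hj : j = i
      · subst hj
        simp only [Function.update_self]
        rw [head_act_some, h.side, hsymmid, if_neg (fun e => hne e.2), List.nil_append,
          Turing.ListBlank.head_mk]
      · simp [hj, h.view, MessagePassing.view]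
    · ext x
      simp only [Set.empty_union, Set.mem_ofPred_eq]
      rw [letters_congr x.1 false h2]
    · simp only
      rw [h4, hsymmid]
      by_cases hj : j = i
      · subst hj
        rw [Function.update_self, side_act_some, h.side, h.side]
        by_cases hd : d' = d
        · subst hd
          simp [hne, Turing.ListBlank.tail_mk]
        · have hd' : d.opp = d' := by cases d <;> cases d' <;> simp_all [Turing.Dir.opp]
          simp [hd, hd', Turing.ListBlank.cons_mk]
      · have hj' : ¬ i = j := fun e => hj e.symm
        simp [hj, hj', h.side]

theorem step (h : Represents K row C) {e : M.Event} (hs : M.Step C e C') :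
    e ∈ M.machine.enabled K ∧ (M.machine.swept K row e).1.1 = e ∧
    Represents (M.machine.swept K row e).1.2.2 (M.machine.swept K row e).2 C' := by
  cases hs with
  | comp i q a d o ha => exact ⟨trivial, h.comp ha⟩
  | deliver i m s hs => exact ⟨h.enabled_iff.2 (by simp [hs]), h.deliver hs⟩

end Represents

end MessagePassing

/-! ### Histories and their tile configurations -/

namespace DistSystem

variable {S : DistSystem}

theorem unfold_reaches_of_suffix {H H' : S.History} (h : H.trace <:+ H'.trace) :
    S.unfold.Reaches H H' := by
  obtain ⟨l', hl'⟩ := H'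
  induction l' with
  | nil =>
    rw [show H = ⟨[], hl'⟩ from History.ext (List.suffix_nil.1 h)]
    exact .refl
  | cons a l' ih =>
    rcases List.suffix_cons_iff.1 h with h | h
    · rw [show H = ⟨a :: l', hl'⟩ from History.ext h]
      exact .refl
    · exact (ih hl'.2 h).tail ⟨a.1, rfl⟩

theorem reaches_current (H : S.History) : S.Reaches S.start H.current := by
  obtain ⟨l, hl⟩ := H
  induction l with
  | nil => exact .refl
  | cons a l ih => exact (ih hl.2).tail ⟨a.1, hl.1⟩

end DistSystem

namespace MessagePassing

open TileData DistSystem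

variable {M : MessagePassing}

/-- Processes are deterministic and a delivery names its message and addressee; so the events alone
determine a history, and the tiles need to record nothing more. -/
theorem Step.unique {C D D' : M.Config} {e : M.Event} (h : M.Step C e D) (h' : M.Step C e D') :
    D = D' := by
  cases h with
  | comp i q a d o ha =>
    cases h' with
    | comp _ q' a' d' o' ha' =>
      rw [ha] at ha'
      obtain ⟨rfl, rfl, rfl, rfl⟩ : q = q' ∧ a = a' ∧ d = d' ∧ o = o' := by simpa using ha'
      rfl
  | deliver i m s hs =>
    cases h' with
    | deliver _ _ s' hs' =>
      rw [hs, Multiset.cons_inj_right] at hs'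
      rw [hs']

theorem trace_eq_of_events_eq {l l' : List (M.Event × M.Config)} (h : M.system.Legal l)
    (h' : M.system.Legal l') (he : l.map Prod.fst = l'.map Prod.fst) : l = l' := by
  induction l generalizing l' with
  | nil => exact (List.map_eq_nil_iff.1 he.symm).symm
  | cons a l ih =>
    cases l' with
    | nil => simp at he
    | cons a' l' =>
      obtain ⟨e, C⟩ := a
      obtain ⟨e', C'⟩ := a'
      obtain ⟨rfl, he'⟩ : e = e' ∧ l.map Prod.fst = l'.map Prod.fst := List.cons.inj he
      obtain rfl := ih h.2 h'.2 he'
      rw [show C = C' from Step.unique h.1 h'.1]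

theorem suffix_of_events_suffix {l l' : List (M.Event × M.Config)} (h : M.system.Legal l)
    (h' : M.system.Legal l') (he : l.map Prod.fst <:+ l'.map Prod.fst) : l <:+ l' := by
  obtain ⟨u, hu⟩ := he
  obtain ⟨u', v, rfl, -, hv⟩ := List.map_eq_append_iff.1 hu.symm
  have hvl : M.system.Legal v := Legal.of_suffix (List.suffix_append _ _) h'
  rw [trace_eq_of_events_eq h hvl hv.symm]
  exact List.suffix_append _ _

/-- The events of a history, latest first. -/
def events (H : M.system.History) : List M.Event := List.map Prod.fst H.trace

theorem events_of_step {H H' : M.system.History} {φ : M.Event}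
    (h : M.system.unfold.Step H φ H') : events H' = φ :: events H := by
  unfold events
  rw [show H'.trace = _ from h]
  rfl

theorem represents_events (H : M.system.History) : M.machine.Valid (events H) ∧
    Represents (M.machine.run (events H)).1 (M.machine.run (events H)).2 H.current := by
  obtain ⟨l, hl⟩ := H
  induction l with
  | nil => exact ⟨trivial, represents_init⟩
  | cons a l ih =>
    obtain ⟨hv, hr⟩ := ih hl.2
    obtain ⟨he, -, hr'⟩ := hr.step hl.1
    exact ⟨⟨he, hv⟩, hr'⟩

variable (M) in
/-- The tile configuration that represents a history. -/
noncomputable def assembly (H : M.system.History) : M.machine.tiles.Assembly :=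
  M.machine.asm (events H)

theorem suffix_of_assembly_sub {H H' : M.system.History} (h : Sub (M.assembly H) (M.assembly H')) :
    H.trace <:+ H'.trace :=
  suffix_of_events_suffix H.legal H'.legal
    (SweepMachine.suffix_of_sub (represents_events H).1 (represents_events H').1 h)

/-- The row machine permits a computation step at any time; `RunsForever` makes this legal. -/
theorem enabled_iff (hM : M.RunsForever) (H : M.system.History) (e : M.Event) :
    Enabled H e ↔ e ∈ M.machine.enabled (M.machine.run (events H)).1 := by
  constructor
  · rintro ⟨C, hC⟩
    exact ((represents_events H).2.step hC).1
  · intro he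
    cases e with
    | comp i =>
      obtain ⟨⟨q, a, d, o⟩, h⟩ := Option.ne_none_iff_exists'.1 (hM _ (reaches_current H) i)
      exact ⟨_, Step.comp _ i q a d o h⟩
    | deliver i m =>
      obtain ⟨s, hs⟩ := Multiset.exists_cons_of_mem ((represents_events H).2.enabled_iff.1 he)
      exact ⟨_, Step.deliver _ i m s hs⟩

theorem enabled_comp (hM : M.RunsForever) (H : M.system.History) (i : Bool) :
    Enabled H (Event.comp i : M.Event) := (enabled_iff hM H _).2 trivial

theorem enabled_deliver_iff (hM : M.RunsForever) (H : M.system.History) (i : Bool) (m : M.Msg) :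
    Enabled H (Event.deliver i m : M.Event) ↔ m ∈ H.current.transit i :=
  (enabled_iff hM H _).trans (represents_events H).2.enabled_iff

theorem mem_transit_of_step {C C' : M.Config} {e : M.Event} (h : M.Step C e C') {i : Bool}
    {m : M.Msg} (he : e ≠ .deliver i m) (hm : m ∈ C.transit i) : m ∈ C'.transit i := by
  cases h with
  | comp j q a d o ha =>
    simp only
    by_cases hj : i = !j
    · subst hj
      cases o <;> simp [post, hm]
    · simpa [hj] using hm
  | deliver j m' s hs =>
    simp only
    by_cases hj : i = j
    · subst hj
      rw [hs, Multiset.mem_cons] at hm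
      have : m ≠ m' := by
        rintro rfl
        exact he rfl
      simpa using hm.resolve_left this
    · simpa [hj] using hm

/-- Computation steps are always possible, and a message in transit stays there until it is
delivered. -/
theorem persistent (hM : M.RunsForever) : Persistent M.system := by
  intro H H' φ e hφ hs hne
  cases φ with
  | comp i => exact enabled_comp hM _ _
  | deliver i m =>
    rw [enabled_deliver_iff hM] at hφ ⊢
    exact mem_transit_of_step (step_of_unfold hs) hne hφ

-- Outside `G` the hitting probability is the average over the choice tiles, one per possible event.
-- The forced growth after a choice ends in the next history, where the hitting probability is no
-- larger (`hit_le_of_forced`); the complement satisfies the required inequality. Positivity of `f`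
-- guarantees that `G` has not been met.
open Classical in
theorem subAverage (hM : M.RunsForever) (G : Set M.machine.tiles.Assembly) :
    SubAverage fun H : M.system.History => 1 - hit G (M.assembly H) := by
  have := Fintype.ofFinite M.Event
  intro H
  let A : Finset M.Event := Finset.univ.filter fun e => Enabled H e
  have hA : ∀ e, e ∈ A ↔ Enabled H e := fun e => by simp [A]
  have hnext : ∀ e : M.Event, ∃ H' : M.system.History, Enabled H e → M.system.unfold.Step H e H' := by
    intro e
    by_cases he : Enabled H e
    · exact ⟨H.snoc he.choose_spec, fun _ => H.step_snoc _⟩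
    · exact ⟨H, fun h => absurd h he⟩
  choose next hnext using hnext
  refine ⟨A, next, hA, fun e he => hnext e ((hA e).1 he), fun hpos => ?_⟩
  obtain ⟨hv, hr⟩ := represents_events H
  have hG : M.assembly H ∉ G := fun h => by
    simp only [hit_of_mem h] at hpos
    linarith
  have hatt := (SweepMachine.ready_asm hv).attachments_eq
  let tile : M.Event → (ℤ × ℤ) × M.machine.tiles.Tile := fun e =>
    ((0, 2 * (events H).length), (.choice (M.machine.run (events H)).1 e : M.machine.Tile))
  have htile : Function.Injective tile := fun e e' h => by simpa [tile] using h
  have hfin : (M.machine.tiles.attachments (M.assembly H)).Finite := by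
    unfold assembly
    rw [hatt]
    exact (Set.toFinite _).image _
  have hset : hfin.toFinset = A.image tile := by
    ext a
    rw [Set.Finite.mem_toFinset, Finset.mem_image]
    unfold assembly
    rw [hatt, Set.mem_image]
    simp only [hA, enabled_iff hM]
    rfl
  have havg := hit_eq_average hG hfin
  rw [hset, Finset.sum_image fun _ _ _ _ h => htile h, Finset.card_image_of_injective _ htile]
    at havg
  have hle : ∑ e ∈ A, hit G (M.assembly (next e)) ≤
      ∑ e ∈ A, hit G (M.machine.tiles.attach (M.assembly H) (tile e)) := by
    refine Finset.sum_le_sum fun e he => hit_le_of_forced ?_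
    have hs := events_of_step (hnext e ((hA e).1 he))
    unfold assembly
    rw [hs]
    refine SweepMachine.forced_asm ?_
    rw [← hs]
    exact (represents_events _).1
  have hcard : (0 : ℝ) < A.card := by
    exact_mod_cast Finset.card_pos.2 ⟨.comp true, (hA _).2 (enabled_comp hM _ _)⟩
  rw [eq_div_iff hcard.ne'] at havg
  change (1 - hit G (M.assembly H)) * (A.card : ℝ) ≤ ∑ e ∈ A, (1 - hit G (M.assembly (next e)))
  rw [Finset.sum_sub_distrib, sub_mul, havg, Finset.sum_const, nsmul_eq_mul]
  linarith

/-- A positive probability of failure would persist along some fair run, but it is 0 at the point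
where that run meets `𝒞`. -/
theorem almostSurelyMeets (hM : M.RunsForever) (H : M.system.History) (𝒞 : Set M.system.History)
    (h : M.system.unfold.MustReach H 𝒞) :
    M.machine.tiles.AlmostSurelyMeets (M.assembly H) (M.assembly '' 𝒞) := by
  have hlim := tendsto_hitProb (M.assembly '' 𝒞) (M.assembly H)
  suffices hone : hit (M.assembly '' 𝒞) (M.assembly H) = 1 by
    rwa [hone] at hlim
  by_contra hne
  have hpos : 0 < 1 - hit (M.assembly '' 𝒞) (M.assembly H) :=
    sub_pos.2 (lt_of_le_of_ne (hit_le_one _ _) hne)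
  have : Finite M.system.Event := inferInstanceAs (Finite M.Event)
  obtain ⟨run, ev, h0, hstep, hrun, hfair⟩ := exists_fair_run
    (f := fun H : M.system.History => 1 - hit (M.assembly '' 𝒞) (M.assembly H))
    (fun H => by
      have : 0 ≤ hit (M.assembly '' 𝒞) (M.assembly H) :=
        Real.iSup_nonneg fun n => hitProb_nonneg _ n _
      linarith)
    (subAverage hM _) (persistent hM) (fun H => ⟨_, enabled_comp hM H true⟩) hpos
  obtain ⟨n, hn⟩ := h run ev h0 hstep
    ⟨fun i n => hfair (.comp i) n (enabled_comp hM _ _),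
      fun i m n hm => hfair (.deliver i m) n ((enabled_deliver_iff hM _ _ _).2 hm)⟩
  have := hrun n
  simp only [hit_of_mem (Set.mem_image_of_mem M.assembly hn), sub_self, lt_irrefl] at this

theorem simulates (hM : M.RunsForever) :
    Simulates M.machine.system M.system.unfold M.assembly where
  injective := fun H H' h => by
    have h1 := suffix_of_assembly_sub (H := H) (H' := H') (h ▸ Sub.refl _)
    have h2 := suffix_of_assembly_sub (H := H') (H' := H) (h ▸ Sub.refl _)
    exact History.ext (h1.eq_of_length_le h2.length_le)
  stable := fun H => SweepMachine.stable_asm (represents_events H).1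
  seed := rfl
  models := fun H φ H' h => by
    unfold assembly
    rw [events_of_step h]
    refine SweepMachine.produces_asm_cons ?_
    rw [← events_of_step h]
    exact (represents_events H').1
  reflects := fun H H' hr hp => hr (unfold_reaches_of_suffix (suffix_of_assembly_sub hp.sub))
  progress := almostSurelyMeets hM
  -- Vacuous, as no reachable configuration is halted.
  halted := fun H h => absurd (h true) (hM _ (reaches_current H) true)

/-- The event, and the control states and scanned symbols that result from it. -/
def mark : M.machine.Tile → Option (M.Event × (Bool → M.State × M.Symbol))
  | .final b => some (b.1, b.2.2.1)
  | _ => none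

/-- The backward state carries the event to the left end. There the `final` tile, the only one in
its block, holds it together with the new control states and the scanned symbols, the latter
complete only after the backward sweep. -/
theorem records : M.Records M.machine.system M.assembly := by
  refine ⟨mark, fun H φ H' h => ?_⟩
  obtain ⟨hv, hr⟩ := represents_events H
  obtain ⟨-, he, hr'⟩ := hr.step (step_of_unfold h)
  have hev := events_of_step h
  refine ⟨(0, 2 * (events H).length + 1), ⟨?_, (.final (M.machine.swept (M.machine.run (events H)).1
    (M.machine.run (events H)).2 φ).1 : M.machine.Tile), ?_, ?_⟩, ?_⟩
  · exact (SweepMachine.ready_asm hv).empty _ _ (by simp)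
  · unfold assembly
    rw [hev]
    exact SweepMachine.asm_cons_final
  · simp only [mark]
    rw [he, ← hr'.view]
  · intro p t hp ht hm
    unfold assembly at hp ht
    rw [hev] at ht
    cases t with
    | final b => exact SweepMachine.eq_of_final hp ht
    | _ => exact absurd rfl hm

end MessagePassing

theorem theorem2 (M : MessagePassing) (hM : M.RunsForever) :
    ∃ (T : TileSystem) (h : M.system.unfold.Config → T.Assembly),
      Simulates T M.system.unfold h ∧ M.Records T h :=
  ⟨M.machine.system, M.assembly, MessagePassing.simulates hM, MessagePassing.records⟩
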